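/- Let $N$ be an oriented $3$-dimensional hyperbolic cone-manifold (a metric space in which every point has an open neighbourhood isometric to an open subset of $\mathbb H^3$ or to a ball centred on the edge of the cone obtained from a wedge of dihedral angle $\theta$ in $\mathbb H^3$ by identifying its two faces by a rotation about the edge), whose singular locus $\Sigma$, the set of points with no neighbourhood isometric to an open subset of $\mathbb H^3$, is a simple closed curve, with cone angle $0<\theta<2\pi$. For $r>0$, a standard tube of radius $r$ around $\Sigma$ is an open neighbourhood of $\Sigma$ locally isometric, by a bijection taking core to $\Sigma$, to the quotient of the open $r$-neighbourhood of the edge of the (infinite) cone of angle $\theta$ by the infinite cyclic group generated by a screw motion along the edge with positive translation length. Assume that there is a largest radius $R$ of such tubes, and let $U$ be the tube of radius $R$ (the maximal tube). Let $\widetilde{N-\Sigma}\to N-\Sigma$ be the universal covering, on which $\pi_1(N-\Sigma)$ acts by deck transformations, and let $\rho:\pi_1(N-\Sigma)\to \mathrm{PSL}_2(\mathbb C)$ be a holonomy representation of the hyperbolic structure on $N-\Sigma$, that is, there is a locally isometric map $\mathrm{dev}:\widetilde{N-\Sigma}\to\mathbb H^3$ with $\mathrm{dev}\circ g=\rho(g)\circ\mathrm{dev}$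 for all $g\in\pi_1(N-\Sigma)$. Let $\widetilde U_0$ be a component of the preimage of $U-\Sigma$ in $\widetilde{N-\Sigma}$ and let $P$ be its stabilizer, a peripheral subgroup of $\pi_1(N-\Sigma)$. Let $x$ be a point of self-tangency of the boundary torus of $U$, and take a geodesic arc of length $2R$ which is the union of two shortest paths from $x$ to $\Sigma$. Lift it (without its endpoints, which are on $\Sigma$) to $\widetilde{N-\Sigma}$ so that the lift $\tilde x_0$ of $x$ is on the boundary of $\widetilde U_0$ and of another lift $\widetilde U_0'$ of $U-\Sigma$, and the two open halves of the arc lie in $\widetilde U_0$ and in $\widetilde U_0'$, respectively. The tie class of the maximal tube at $x$ is the class of an element $\beta\in\pi_1(N-\Sigma)$ with $\beta(\widetilde U_0')=\widetilde U_0$, under the equivalence relation in which $\alpha\sim\beta$ if and only if $\alpha=\gamma_1\beta\gamma_2$ or $\alpha=\gamma_1\beta^{-1}\gamma_2$ for some $\gamma_1,\gamma_2\in P$. If $\alpha\in\pi_1(N-\Sigma)$ represents a tie class for the maximal tube, then for every $\gamma\in P$ with $\rho(\gamma)\neq I$ the radius $R$ of the maximal tube satisfies $$\cosh(2R)=\frac{\left|\mathrm{tr}\,\rho(\alpha\gamma\alpha^{-1}\gamma^{-1})-2\right|+\left|\mathrm{tr}^2\rho(\gamma)-\mathrm{tr}\,\rho(\alpha\gamma\alpha^{-1}\gamma^{-1})-2\right|}{\left|\mathrm{tr}^2\rho(\gamma)-4\right|}.$$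 Here $\mathrm{tr}^2\rho(\gamma)$ and $\mathrm{tr}\,\rho(\alpha\gamma\alpha^{-1}\gamma^{-1})$ are computed as $(\mathrm{tr}\,G)^2$ and $\mathrm{tr}(AGA^{-1}G^{-1})$ from any $A,G\in\mathrm{SL}_2(\mathbb C)$ representing $\rho(\alpha)$ and $\rho(\gamma)$; they do not depend on the choice. -/

import Mathlib

open Set Filter Topology
open scoped NNReal MatrixGroups ComplexOrder

noncomputable section

namespace HypCone

/-! ### Hyperbolic 3-space and its group of orientation preserving isometries -/

/-- Hyperbolic 3-space, as the hyperboloid of positive definite Hermitian `2 × 2` matrices of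
determinant `1`. The point `(z, t)` of the upper half-space `ℂ × (0, ∞)` corresponds to the matrix
`t⁻¹ • !![|z|² + t², z; conj z, 1]`, and the geodesic from `0` to `∞` is the set of the diagonal
matrices `diag(eˢ, e⁻ˢ)`, where `s` is arc length. -/
def H3 : Type := {A : Matrix (Fin 2) (Fin 2) ℂ // A.PosDef ∧ A.det = 1}

instance : TopologicalSpace H3 :=
  inferInstanceAs (TopologicalSpace {A : Matrix (Fin 2) (Fin 2) ℂ // A.PosDef ∧ A.det = 1})

/-- The hyperbolic distance (curvature `-1`): `cosh d(A, B) = tr (A⁻¹ B) / 2`. -/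
def H3.dist (A B : H3) : ℝ := Real.arcosh ((A.1⁻¹ * B.1).trace.re / 2)

/-- `SL(2, ℂ)` acts on `H3` by `A ↦ g A gᴴ`; this is the action by Möbius transformations of the
upper half-space. -/
instance : MulAction SL(2, ℂ) H3 where
  smul g A := ⟨g.1 * A.1 * g.1.conjTranspose, by
    refine ⟨A.2.1.mul_mul_conjTranspose_same ?_, ?_⟩
    · rw [Matrix.vecMul_injective_iff_isUnit, Matrix.isUnit_iff_isUnit_det, g.2]
      exact isUnit_one
    · rw [Matrix.det_mul, Matrix.det_mul, Matrix.det_conjTranspose, g.2, A.2.2]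
      simp⟩
  one_smul A := Subtype.ext (by
    change (1 : SL(2, ℂ)).1 * A.1 * (1 : SL(2, ℂ)).1.conjTranspose = A.1
    simp)
  mul_smul g h A := Subtype.ext (by
    change (g * h).1 * A.1 * (g * h).1.conjTranspose =
      g.1 * (h.1 * A.1 * h.1.conjTranspose) * g.1.conjTranspose
    simp [Matrix.mul_assoc])

/-- `PSL(2, ℂ)`, the quotient of `SL(2, ℂ)` by its centre `{1, -1}`. -/
abbrev PSL2C : Type := Matrix.ProjectiveSpecialLinearGroup (Fin 2) ℂ

/-! ### The hyperbolic cone -/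

/-- Cylindrical coordinates `(r, φ, z)` around a geodesic: `r` is the distance to the geodesic, `φ`
the angle around it, and `z` the arc length along it. -/
abbrev Cyl : Type := ℝ≥0 × ℝ × ℝ

/-- The distance in the hyperbolic cone of cone angle `θ`, `0 < θ < 2π`, that is, in the quotient
metric space obtained from a wedge of dihedral angle `θ` in hyperbolic space by identifying its two
faces by the rotation about the edge. The norm of `AddCircle θ = ℝ / θℤ` is the distance to the
nearest multiple of `θ`, so it is the angle between the two half-planes through the edge. -/
def coneDist (θ : ℝ) (a b : Cyl) : ℝ :=
  Real.arcosh (Real.cosh a.1 * Real.cosh b.1 * Real.cosh (a.2.2 - b.2.2) -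
    Real.sinh a.1 * Real.sinh b.1 * Real.cos ‖((a.2.1 - b.2.1 : ℝ) : AddCircle θ)‖)

/-- Open balls of the hyperbolic cone. -/
def coneBall (θ : ℝ) (a : Cyl) (ε : ℝ) : Set Cyl := {b | coneDist θ a b < ε}

/-- `f` maps the open ball of radius `ε` around `a` in the hyperbolic cone of angle `θ`
isometrically onto an open subset of `N`. -/
def IsIsometricOnConeBall {N : Type*} [MetricSpace N] (θ : ℝ) (f : Cyl → N) (a : Cyl) (ε : ℝ) :
    Prop :=
  (∀ b ∈ coneBall θ a ε, ∀ c ∈ coneBall θ a ε, dist (f b) (f c) = coneDist θ b c) ∧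
    IsOpen (f '' coneBall θ a ε)

/-! ### Hyperbolic cone-manifolds -/

/-- `x` has an open neighbourhood isometric to an open subset of hyperbolic space. -/
def IsRegularPoint {N : Type*} [MetricSpace N] (x : N) : Prop :=
  ∃ V : Set N, IsOpen V ∧ x ∈ V ∧ ∃ h : N → H3,
    (∀ y ∈ V, ∀ y' ∈ V, (h y).dist (h y') = dist y y') ∧ IsOpen (h '' V)

/-- `x` has an open neighbourhood isometric to a ball around a point of the edge of the hyperbolic
cone of angle `θ`. -/
def IsConePoint {N : Type*} [MetricSpace N] (θ : ℝ) (x : N) : Prop :=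
  ∃ ε > 0, ∃ f : Cyl → N, f (0, 0, 0) = x ∧ IsIsometricOnConeBall θ f (0, 0, 0) ε

/-- The singular locus `Σ`. -/
def singularLocus (N : Type*) [MetricSpace N] : Set N := {x | ¬ IsRegularPoint x}

/-- The complement `N - Σ` of the singular locus. -/
abbrev regularPart (N : Type*) [MetricSpace N] : Type _ := {x : N // x ∉ singularLocus N}

/-- `N` is a hyperbolic cone-manifold whose singular locus is a simple closed curve, with cone angle
`θ` less than `2π`. -/
structure IsConeManifoldAlongKnot (N : Type*) [MetricSpace N] (θ : ℝ) : Prop where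
  angle_pos : 0 < θ
  angle_lt : θ < 2 * Real.pi
  conePoint : ∀ x ∈ singularLocus N, IsConePoint θ x
  knot : Nonempty (singularLocus N ≃ₜ Circle)

/-! ### Tubes around the singular locus -/

/-- `U` is a standard open tube of radius `R` around the singular locus of `N`: it is the isometric
image (for the local metrics) of the solid torus obtained from the part `r < R` of the hyperbolic
cone of angle `θ` by dividing by the group generated by the screw motion
`(r, φ, z) ↦ (r, φ + τ, z + ℓ)`, and the core `r = 0` corresponds to the singular locus. -/
def IsTube {N : Type*} [MetricSpace N] (θ R : ℝ) (U : Set N) : Prop :=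
  0 < R ∧ ∃ (ℓ τ : ℝ) (f : Cyl → N), 0 < ℓ ∧
    (∀ a : Cyl, (a.1 : ℝ) < R → ∃ ε > 0, IsIsometricOnConeBall θ f a ε) ∧
    (∀ a b : Cyl, (a.1 : ℝ) < R → (b.1 : ℝ) < R →
      (f a = f b ↔ a.1 = b.1 ∧ ∃ n : ℤ, b.2.2 = a.2.2 + n * ℓ ∧
        (a.1 = 0 ∨ ∃ m : ℤ, b.2.1 = a.2.1 + n * τ + m * θ))) ∧
    f '' {a | a.1 = 0} = singularLocus N ∧
    f '' {a | (a.1 : ℝ) < R} = U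

/-- `U` is the maximal (open) tube around the singular locus, and `R` is its radius. -/
def IsMaximalTube {N : Type*} [MetricSpace N] (θ R : ℝ) (U : Set N) : Prop :=
  IsTube θ R U ∧ ∀ (R' : ℝ) (U' : Set N), IsTube θ R' U' → R' ≤ R

/-! ### The universal covering of `N - Σ` and the holonomy -/

/-- The group of deck transformations of `p`. When `p` is the universal covering of a connected
manifold `Y`, this is the fundamental group of `Y`. -/
def deckGroup {X Y : Type*} [TopologicalSpace X] (p : X → Y) : Subgroup (X ≃ₜ X) where
  carrier := {g | ∀ x, p (g x) = p x}
  mul_mem' {g h} hg hh x := by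
    change p (g (h x)) = p x
    rw [hg, hh]
  one_mem' _ := rfl
  inv_mem' {g} hg x := by
    change p (g.symm x) = p x
    rw [← hg (g.symm x), g.apply_symm_apply]

/-- `dev` is a developing map and `ρ` the corresponding holonomy representation for the hyperbolic
structure of `N - Σ`: `dev` is locally isometric and `dev ∘ g = ρ g ∘ dev`. Since `ρ g` is a class
of matrices `{A, -A}`, the last condition is written for the representatives `A`. -/
def IsDevelopingPair {N X : Type*} [MetricSpace N] [TopologicalSpace X] (p : X → regularPart N)
    (dev : X → H3) (ρ : deckGroup p →* PSL2C) : Prop :=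
  (∀ x, ∃ V ∈ 𝓝 x, ∀ y ∈ V, ∀ y' ∈ V, (dev y).dist (dev y') = dist (p y) (p y')) ∧
  ∀ (g : deckGroup p) (A : SL(2, ℂ)), (A : PSL2C) = ρ g → ∀ x, dev (g.1 x) = A • dev x

/-- `ρ` is a holonomy representation of the hyperbolic structure of `N - Σ`. -/
def IsHolonomy {N X : Type*} [MetricSpace N] [TopologicalSpace X] (p : X → regularPart N)
    (ρ : deckGroup p →* PSL2C) : Prop :=
  ∃ dev : X → H3, IsDevelopingPair p dev ρ

/-! ### Peripheral subgroups and tie classes -/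

/-- `U₀` is a connected component of the preimage of `U - Σ` in the covering space `X` of
`N - Σ`. -/
def IsLiftComponent {N X : Type*} [MetricSpace N] [TopologicalSpace X] (p : X → regularPart N)
    (U : Set N) (U₀ : Set X) : Prop :=
  ∃ x ∈ {y | (p y : N) ∈ U}, U₀ = connectedComponentIn {y | (p y : N) ∈ U} x

/-- The subgroup of the deck transformations that leave `U₀` invariant. When `U₀` is a component of
the preimage of `U - Σ` in the universal covering of `N - Σ`, where `U` is a tube around `Σ`, this
is the image of the fundamental group of `U - Σ`, that is, a peripheral subgroup of the fundamental
group of `N - Σ`; all of its peripheral subgroups (which are conjugate to each other) are of this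
form. -/
def peripheralSubgroup {X Y : Type*} [TopologicalSpace X] (p : X → Y) (U₀ : Set X) :
    Subgroup (deckGroup p) where
  carrier := {g | g.1 '' U₀ = U₀}
  mul_mem' {g h} hg hh := by
    change (fun x => g.1 (h.1 x)) '' U₀ = U₀
    rw [← Set.image_image (fun y => g.1 y) (fun y => h.1 y)]
    rw [show (fun y => h.1 y) '' U₀ = U₀ from hh]
    exact hg
  one_mem' := Set.image_id U₀
  inv_mem' {g} hg := by
    change g.1.symm '' U₀ = U₀
    conv_lhs => rw [← show g.1 '' U₀ = U₀ from hg]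
    rw [Set.image_image]
    simp

/-- `σ`, restricted to `(-R, R)`, is a lift to the covering space of a geodesic arc which is the
union of two shortest paths, of length `R`, from a point of the boundary torus of the tube to the
singular locus. It is parametrized by arc length, `σ 0` lies over the point of the torus, one half
of the arc lies in the lift `U₀` of the tube, and the other half in the lift `U₀'`, so that the two
lifts touch each other at `σ 0`. -/
structure IsTieArc {N X : Type*} [MetricSpace N] [TopologicalSpace X] (p : X → regularPart N)
    (R : ℝ) (U₀ U₀' : Set X) (σ : ℝ → X) : Prop where
  continuousOn : ContinuousOn σ (Ioo (-R) R)
  geodesic : ∀ s ∈ Ioo (-R) R, ∃ δ > 0, ∀ s₁ ∈ Ioo (-R) R, ∀ s₂ ∈ Ioo (-R) R,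
    |s₁ - s| < δ → |s₂ - s| < δ → dist (p (σ s₁)) (p (σ s₂)) = |s₁ - s₂|
  start : Tendsto (fun s => Metric.infDist (p (σ s) : N) (singularLocus N)) (𝓝[>] (-R)) (𝓝 0)
  finish : Tendsto (fun s => Metric.infDist (p (σ s) : N) (singularLocus N)) (𝓝[<] R) (𝓝 0)
  mid : σ 0 ∈ frontier U₀ ∩ frontier U₀'
  left : ∀ s ∈ Ioo (-R) 0, σ s ∈ U₀
  right : ∀ s ∈ Ioo 0 R, σ s ∈ U₀'

/-- `α` represents a tie class of the tube of radius `R` whose lift is `U₀`: up to the equivalence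
relation `α ∼ γ₁ β γ₂`, `α ∼ γ₁ β⁻¹ γ₂` with `γ₁`, `γ₂` in the peripheral subgroup, it is a
deck transformation `β` with `β U₀' = U₀`, where `U₀'` is the second lift of the tube that is
met by the lift of the geodesic arc at a point of self-tangency. -/
def RepresentsTieClass {N X : Type*} [MetricSpace N] [TopologicalSpace X] (p : X → regularPart N)
    (R : ℝ) (U₀ : Set X) (α : deckGroup p) : Prop :=
  ∃ (β : deckGroup p) (U₀' : Set X) (σ : ℝ → X), IsTieArc p R U₀ U₀' σ ∧ β.1 '' U₀' = U₀ ∧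
    ∃ γ₁ ∈ peripheralSubgroup p U₀, ∃ γ₂ ∈ peripheralSubgroup p U₀,
      α = γ₁ * β * γ₂ ∨ α = γ₁ * β⁻¹ * γ₂

end HypCone

end

noncomputable section

namespace HypCone

/-! ### The polarized determinant -/

/-! Hyperbolic space is the hyperboloid of positive Hermitian matrices of determinant 1, and
`detPolar` is the Lorentz form: distances are read off from it, geodesics are `eˢ K + e⁻ˢ K'` with
`K`, `K'` null, and `SL(2, ℂ)` acts by isometries.

On a lift of the tube without its core, cylindrical coordinates give a parametrization `F`, and `dev
∘ F` is a local isometry. Having the Gram matrix of a spanning family, it is the restriction of a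
linear isometry of the form, so after conjugation by some `h` in `SL(2, ℂ)` it is again given by
cylindrical coordinates around the geodesic from 0 to ∞, up to the angle
(`exists_cylindrical_frame`). In this frame peripheral elements are diagonal (`IsLift.fixesAxis`).

The tie arc develops to a geodesic that starts on the axis. If it were not perpendicular to the
axis, its distance from the axis at time 0 would be less than `R`, so `σ 0` would still be inside
the open lift, not on its frontier (`IsLift.perpendicular`). The same holds at the other end after
applying `β`. Hence the developed arc is the common perpendicular, of length `2R`, of the axis and
of its preimage under the holonomy of `β`. If `a, b, c, d` are the entries of that holonomy in the
frame, then `cosh 2R = |ad| + |bc|` (`axisCosh_eq_cosh`). This number depends only on the tie class.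

Finally, for `G = diag(λ, λ⁻¹)` and `A` with entries `a, b, c, d`, one has `tr [A, G] - 2 = -bc D`,
`tr² G - tr [A, G] - 2 = ad D` and `tr² G - 4 = D`, where `D = (λ - λ⁻¹)²` is nonzero because `G ≠
±1`. The quotient of traces is therefore `|ad| + |bc|` (`axisCosh_eq_trace`). -/

/-- The polarization of the determinant of `2 × 2` matrices. -/
def detPolar : Matrix (Fin 2) (Fin 2) ℂ →ₗ[ℂ] Matrix (Fin 2) (Fin 2) ℂ →ₗ[ℂ] ℂ :=
  LinearMap.mk₂ ℂ (fun A B => A 0 0 * B 1 1 + A 1 1 * B 0 0 - A 0 1 * B 1 0 - A 1 0 * B 0 1)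
    (by intros; simp; ring) (by intros; simp; ring) (by intros; simp; ring) (by intros; simp; ring)

theorem detPolar_apply (A B : Matrix (Fin 2) (Fin 2) ℂ) :
    detPolar A B = A 0 0 * B 1 1 + A 1 1 * B 0 0 - A 0 1 * B 1 0 - A 1 0 * B 0 1 := rfl

theorem detPolar_comm (A B : Matrix (Fin 2) (Fin 2) ℂ) : detPolar A B = detPolar B A := by
  simp only [detPolar_apply]; ring

theorem detPolar_self (A : Matrix (Fin 2) (Fin 2) ℂ) : detPolar A A = 2 * A.det := by
  rw [detPolar_apply, Matrix.det_fin_two]; ring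

/-- This polarizes `det (g A gᴴ) = |det g|² det A`. In the proof `gᴴ` becomes an independent matrix,
which leaves a polynomial identity. -/
theorem detPolar_smul_smul (g A B : Matrix (Fin 2) (Fin 2) ℂ) (hg : g.det = 1) :
    detPolar (g * A * g.conjTranspose) (g * B * g.conjTranspose) = detPolar A B := by
  have h1 : g.conjTranspose.det = 1 := by rw [Matrix.det_conjTranspose, hg]; simp
  rw [Matrix.det_fin_two] at hg h1
  simp only [detPolar_apply, Matrix.mul_apply, Fin.sum_univ_two]
  generalize g.conjTranspose = k at *
  have : ∀ x y : ℂ, x = (g 0 0 * g 1 1 - g 0 1 * g 1 0) * (k 0 0 * k 1 1 - k 0 1 * k 1 0) * y →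
    x = y := by intro x y h; rw [h, hg, h1]; ring
  apply this
  ring

theorem eq_zero_of_detPolar_eq_zero {A : Matrix (Fin 2) (Fin 2) ℂ} (h : ∀ B, detPolar A B = 0) :
    A = 0 := by
  have h1 := h !![1, 0; 0, 0]
  have h2 := h !![0, 1; 0, 0]
  have h3 := h !![0, 0; 1, 0]
  have h4 := h !![0, 0; 0, 1]
  simp [detPolar_apply] at h1 h2 h3 h4
  ext i j
  fin_cases i <;> fin_cases j <;> simp [*]

/-! ### Points of hyperbolic space -/

/-- A Hermitian matrix given by its diagonal and its upper right entry. -/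
def hermMatrix (a d : ℝ) (b : ℂ) : Matrix (Fin 2) (Fin 2) ℂ := !![(a : ℂ), b; star b, (d : ℂ)]

theorem exists_hermMatrix {A : Matrix (Fin 2) (Fin 2) ℂ} (hA : A.IsHermitian) :
    A = hermMatrix (A 0 0).re (A 1 1).re (A 0 1) := by
  have h0 : star (A 0 0) = A 0 0 := hA.apply 0 0
  have h1 : star (A 1 1) = A 1 1 := hA.apply 1 1
  have h2 : star (A 0 1) = A 1 0 := hA.apply 1 0
  ext i j
  fin_cases i <;> fin_cases j
  · exact (Complex.conj_eq_iff_re.1 h0).symm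
  · rfl
  · exact h2.symm
  · exact (Complex.conj_eq_iff_re.1 h1).symm

theorem detPolar_hermMatrix (a d a' d' : ℝ) (b b' : ℂ) :
    detPolar (hermMatrix a d b) (hermMatrix a' d' b') =
      ((a * d' + d * a' - 2 * (b.re * b'.re + b.im * b'.im) : ℝ) : ℂ) := by
  apply Complex.ext <;> simp [detPolar_apply, hermMatrix] <;> ring

theorem H3.diag_pos (A : H3) (i : Fin 2) : 0 < (A.1 i i).re := by
  have := A.2.1.diag_pos (i := i)
  exact (Complex.pos_iff.1 this).1

theorem H3.det_entries (A : H3) :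
    (A.1 0 0).re * (A.1 1 1).re - Complex.normSq (A.1 0 1) = 1 := by
  have h := A.2.2
  rw [exists_hermMatrix A.2.1.isHermitian] at h
  have h2 := congrArg Complex.re h
  simpa [hermMatrix, Matrix.det_fin_two, Complex.normSq_apply] using h2

theorem H3.detPolar_eq_re (A B : H3) : detPolar A.1 B.1 = ((detPolar A.1 B.1).re : ℂ) := by
  rw [exists_hermMatrix A.2.1.isHermitian, exists_hermMatrix B.2.1.isHermitian,
    detPolar_hermMatrix, Complex.ofReal_re]

/-- The reversed Cauchy–Schwarz inequality of the hyperboloid, from AM–GM on the diagonal entries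
and Cauchy–Schwarz on the off-diagonal ones. It places half the form in `[1, ∞)`, where `arcosh` is
injective. -/
theorem H3.two_le_detPolar (A B : H3) : 2 ≤ (detPolar A.1 B.1).re := by
  have hA := A.det_entries
  have hB := B.det_entries
  have a0 := A.diag_pos 0
  have a1 := A.diag_pos 1
  have b0 := B.diag_pos 0
  have b1 := B.diag_pos 1
  rw [exists_hermMatrix A.2.1.isHermitian, exists_hermMatrix B.2.1.isHermitian,
    detPolar_hermMatrix, Complex.ofReal_re]
  generalize (A.1 0 0).re = a at *
  generalize (A.1 1 1).re = d at *
  generalize (B.1 0 0).re = a' at *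
  generalize (B.1 1 1).re = d' at *
  generalize (A.1 0 1) = b at *
  generalize (B.1 0 1) = b' at *
  rw [Complex.normSq_apply] at hA hB
  set q := b.re * b'.re + b.im * b'.im with hq
  have h1 : (a * d' + d * a') ^ 2 ≥ 4 * ((a * d) * (a' * d')) := by
    nlinarith [sq_nonneg (a * d' - d * a')]
  have h2 : (a * d) * (a' * d') ≥ (1 + q) ^ 2 := by
    rw [show a * d = 1 + (b.re * b.re + b.im * b.im) by linarith,
      show a' * d' = 1 + (b'.re * b'.re + b'.im * b'.im) by linarith]
    nlinarith [sq_nonneg (b.re * b'.im - b.im * b'.re), sq_nonneg (b.re - b'.re),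
      sq_nonneg (b.im - b'.im)]
  have h3 : 0 < a * d' + d * a' := by positivity
  have h4 := abs_le_of_sq_le_sq (show (2 * (1 + q)) ^ 2 ≤ (a * d' + d * a') ^ 2 by nlinarith) h3.le
  have := le_of_abs_le h4
  linarith

/-- The inverse of a matrix of determinant 1 is its adjugate, so the trace in `H3.dist` is the
polarized determinant. -/
theorem H3.dist_eq (A B : H3) : A.dist B = Real.arcosh ((detPolar A.1 B.1).re / 2) := by
  have : (A.1⁻¹ * B.1).trace = detPolar A.1 B.1 := by
    rw [Matrix.inv_def, A.2.2, Matrix.adjugate_fin_two, Matrix.trace_fin_two]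
    simp [Matrix.mul_apply, Fin.sum_univ_two, detPolar_apply]
    ring
  rw [H3.dist, this]

theorem H3.detPolar_eq_of_dist {A B : H3} {x : ℝ} (hx : 1 ≤ x) (h : A.dist B = Real.arcosh x) :
    detPolar A.1 B.1 = ((2 * x : ℝ) : ℂ) := by
  rw [H3.dist_eq] at h
  have := Real.arcosh_injOn (show _ ∈ Ici _ from by
    have := H3.two_le_detPolar A B; simp only [mem_Ici]; linarith) (show _ ∈ Ici _ from hx) h
  rw [H3.detPolar_eq_re, ← this]
  congr 1; ring

theorem H3.coe_smul (g : SL(2, ℂ)) (A : H3) : (g • A).1 = g.1 * A.1 * g.1.conjTranspose := rfl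

/-- A null Hermitian matrix which is orthogonal to a point of hyperbolic space vanishes. -/
theorem eq_zero_of_detPolar_H3 {v : Matrix (Fin 2) (Fin 2) ℂ} (hv : v.IsHermitian) (y : H3)
    (h0 : detPolar v v = 0) (h1 : detPolar v y.1 = 0) : v = 0 := by
  have hy := y.det_entries
  rw [exists_hermMatrix hv] at h0 h1 ⊢
  rw [exists_hermMatrix y.2.1.isHermitian] at h1
  rw [detPolar_hermMatrix, Complex.ofReal_eq_zero] at h0 h1
  have ya := y.diag_pos 0
  have yd := y.diag_pos 1
  rw [Complex.normSq_apply] at hy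
  generalize (y.1 0 0).re = a at *
  generalize (y.1 1 1).re = d at *
  generalize (y.1 0 1) = b at *
  generalize (v 0 0).re = p at *
  generalize (v 1 1).re = s at *
  generalize (v 0 1) = q at *
  have e1 : (p * d + s * a) ^ 2 = 4 * (q.re * b.re + q.im * b.im) ^ 2 := by
    rw [show p * d + s * a = 2 * (q.re * b.re + q.im * b.im) by linarith]; ring
  have e2 : p * s = q.re * q.re + q.im * q.im := by linarith
  -- By Lagrange's identity, the two orthogonality relations and `det y = 1` combine into a
  -- vanishing sum of squares.
  have e3 : (p * d - s * a) ^ 2 + 4 * (q.re ^ 2 + q.im ^ 2) + 4 * (q.re * b.im - q.im * b.re) ^ 2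
      = 0 := by
    linear_combination e1 - 4 * (p * s) * hy - 4 * ((b.re * b.re + b.im * b.im) + 1) * e2
  have q1 : q.re = 0 := by
    nlinarith [sq_nonneg (p * d - s * a), sq_nonneg q.re, sq_nonneg q.im,
      sq_nonneg (q.re * b.im - q.im * b.re)]
  have q2 : q.im = 0 := by
    nlinarith [sq_nonneg (p * d - s * a), sq_nonneg q.re, sq_nonneg q.im,
      sq_nonneg (q.re * b.im - q.im * b.re)]
  have q0 : q = 0 := Complex.ext q1 q2
  subst q0
  simp only [Complex.zero_re, Complex.zero_im] at *
  have hp : p = 0 := by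
    have : p * d - s * a = 0 := by nlinarith [sq_nonneg (p * d - s * a)]
    have : p * d = 0 := by linarith
    rcases mul_eq_zero.1 this with h | h
    · exact h
    · linarith
  have hs : s = 0 := by
    have : s * a = 0 := by subst hp; linarith
    rcases mul_eq_zero.1 this with h | h
    · exact h
    · linarith
  subst hp hs
  ext i j
  fin_cases i <;> fin_cases j <;> simp [hermMatrix]

/-- Gluing of local representations by a uniquely determined parameter. -/
theorem exists_global_parameter {T V Par : Type*} [TopologicalSpace T] [PreconnectedSpace T]
    [Nonempty T] (Φ : Par → T → V) (c : T → V) (h : ∀ t, ∃ k, ∀ᶠ t' in 𝓝 t, c t' = Φ k t')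
    (huniq : ∀ t k k', (∀ᶠ t' in 𝓝 t, Φ k t' = Φ k' t') → k = k') : ∃ k, ∀ t, c t = Φ k t := by
  choose k hk using h
  -- Parameters are determined by germs, so the chosen one is locally constant, hence constant on
  -- the connected space.
  have hc : IsLocallyConstant k := by
    rw [IsLocallyConstant.iff_eventually_eq]
    intro t
    filter_upwards [eventually_eventually_nhds.2 (hk t)] with t' ht'
    exact huniq t' _ _ (by filter_upwards [ht', hk t'] with s h1 h2; rw [← h1, ← h2])
  obtain ⟨t₀⟩ := ‹Nonempty T›
  exact ⟨k t₀, fun t => by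
    rw [hc.apply_eq_of_preconnectedSpace t₀ t]; exact (hk t).self_of_nhds⟩

/-! ### Geodesics -/

/-- The parametrization `s ↦ eˢ K + e⁻ˢ K'` of a geodesic by arc length. -/
def geodesicLine (K : Matrix (Fin 2) (Fin 2) ℂ × Matrix (Fin 2) (Fin 2) ℂ) (s : ℝ) :
    Matrix (Fin 2) (Fin 2) ℂ := (Real.exp s : ℂ) • K.1 + (Real.exp (-s) : ℂ) • K.2

/-- `K` consists of orthonormalized null vectors, so that `geodesicLine K` is a geodesic. -/
structure IsNullPair (K : Matrix (Fin 2) (Fin 2) ℂ × Matrix (Fin 2) (Fin 2) ℂ) : Prop where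
  hermitian_fst : K.1.IsHermitian
  hermitian_snd : K.2.IsHermitian
  null_fst : detPolar K.1 K.1 = 0
  null_snd : detPolar K.2 K.2 = 0
  pairing : detPolar K.1 K.2 = 1

/-- The image of a geodesic under the action of a matrix. -/
def mapPair (g : Matrix (Fin 2) (Fin 2) ℂ)
    (K : Matrix (Fin 2) (Fin 2) ℂ × Matrix (Fin 2) (Fin 2) ℂ) :
    Matrix (Fin 2) (Fin 2) ℂ × Matrix (Fin 2) (Fin 2) ℂ :=
  (g * K.1 * g.conjTranspose, g * K.2 * g.conjTranspose)

theorem geodesicLine_mapPair (g : Matrix (Fin 2) (Fin 2) ℂ)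
    (K : Matrix (Fin 2) (Fin 2) ℂ × Matrix (Fin 2) (Fin 2) ℂ) (s : ℝ) :
    geodesicLine (mapPair g K) s = g * geodesicLine K s * g.conjTranspose := by
  simp only [geodesicLine, mapPair, Matrix.mul_add, Matrix.add_mul, Matrix.mul_smul, Matrix.smul_mul]

theorem geodesicLine_swap (K : Matrix (Fin 2) (Fin 2) ℂ × Matrix (Fin 2) (Fin 2) ℂ) (s : ℝ) :
    geodesicLine K.swap s = geodesicLine K (-s) := by
  simp only [geodesicLine, Prod.fst_swap, Prod.snd_swap, neg_neg, add_comm]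

theorem IsNullPair.map {K : Matrix (Fin 2) (Fin 2) ℂ × Matrix (Fin 2) (Fin 2) ℂ}
    (hK : IsNullPair K) {g : Matrix (Fin 2) (Fin 2) ℂ} (hg : g.det = 1) :
    IsNullPair (mapPair g K) where
  hermitian_fst := Matrix.isHermitian_mul_mul_conjTranspose _ hK.hermitian_fst
  hermitian_snd := Matrix.isHermitian_mul_mul_conjTranspose _ hK.hermitian_snd
  null_fst := (detPolar_smul_smul _ _ _ hg).trans hK.null_fst
  null_snd := (detPolar_smul_smul _ _ _ hg).trans hK.null_snd
  pairing := (detPolar_smul_smul _ _ _ hg).trans hK.pairing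

theorem IsNullPair.swap {K : Matrix (Fin 2) (Fin 2) ℂ × Matrix (Fin 2) (Fin 2) ℂ}
    (hK : IsNullPair K) : IsNullPair K.swap where
  hermitian_fst := hK.hermitian_snd
  hermitian_snd := hK.hermitian_fst
  null_fst := hK.null_snd
  null_snd := hK.null_fst
  pairing := (detPolar_comm _ _).trans hK.pairing

theorem IsNullPair.isHermitian {K : Matrix (Fin 2) (Fin 2) ℂ × Matrix (Fin 2) (Fin 2) ℂ}
    (hK : IsNullPair K) (s : ℝ) : (geodesicLine K s).IsHermitian := by
  rw [Matrix.IsHermitian, geodesicLine, Matrix.conjTranspose_add, Matrix.conjTranspose_smul,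
    Matrix.conjTranspose_smul, hK.hermitian_fst.eq, hK.hermitian_snd.eq, Complex.star_def,
    Complex.conj_ofReal, Complex.conj_ofReal]

theorem IsNullPair.detPolar_geodesicLine
    {K : Matrix (Fin 2) (Fin 2) ℂ × Matrix (Fin 2) (Fin 2) ℂ} (hK : IsNullPair K) (s t : ℝ) :
    detPolar (geodesicLine K s) (geodesicLine K t) = ((2 * Real.cosh (s - t) : ℝ) : ℂ) := by
  have h := (detPolar_comm K.2 K.1).trans hK.pairing
  simp only [geodesicLine, map_add, map_smul, LinearMap.add_apply, LinearMap.smul_apply,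
    smul_eq_mul, hK.null_fst, hK.null_snd, hK.pairing, h]
  norm_cast
  rw [Real.cosh_eq, sub_eq_add_neg, neg_add, neg_neg, Real.exp_add, Real.exp_add]
  ring

theorem continuous_geodesicLine (K : Matrix (Fin 2) (Fin 2) ℂ × Matrix (Fin 2) (Fin 2) ℂ) :
    Continuous (geodesicLine K) := by
  unfold geodesicLine
  fun_prop

/-- A geodesic which meets the geodesic from `0` to `∞` moves away from it at most at the speed of
a perpendicular geodesic. -/
theorem IsNullPair.exists_slope {K : Matrix (Fin 2) (Fin 2) ℂ × Matrix (Fin 2) (Fin 2) ℂ}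
    (hK : IsNullPair K) {R : ℝ} (h : geodesicLine K (-R) 0 1 = 0) :
    ∃ w : ℂ, ‖w‖ ≤ 1 ∧ ∀ s, geodesicLine K s 0 1 = w * Real.sinh (s + R) := by
  set k := K.1 0 1 with hk
  set t := Real.exp (-R) with ht
  have htt : Real.exp R * t = 1 := by rw [ht, ← Real.exp_add]; simp
  have httC : (Real.exp R : ℂ) * t = 1 := by exact_mod_cast htt
  have h2 : K.2 0 1 = -(t ^ 2 : ℝ) * k := by
    simp only [geodesicLine, Matrix.add_apply, Matrix.smul_apply, smul_eq_mul, neg_neg] at h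
    rw [← ht, ← hk] at h
    push_cast [-Complex.ofReal_exp] at h ⊢
    linear_combination (t : ℂ) * h - K.2 0 1 * httC
  refine ⟨2 * t * k, ?_, fun s => ?_⟩
  · have h11 := hK.null_fst
    have h22 := hK.null_snd
    have h12 := hK.pairing
    rw [exists_hermMatrix hK.hermitian_fst] at h11 h12
    rw [exists_hermMatrix hK.hermitian_snd, h2] at h22 h12
    rw [← hk] at h11 h12
    rw [detPolar_hermMatrix, Complex.ofReal_eq_zero] at h11 h22
    rw [detPolar_hermMatrix, Complex.ofReal_eq_one] at h12
    rw [← Complex.ofReal_neg, Complex.re_ofReal_mul, Complex.im_ofReal_mul] at h22 h12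
    have hn : ‖2 * t * k‖ ^ 2 = 4 * t ^ 2 * (k.re * k.re + k.im * k.im) := by
      rw [← Complex.normSq_eq_norm_sq, ← Complex.normSq_apply, map_mul, map_mul,
        Complex.normSq_ofReal, show Complex.normSq 2 = 4 by norm_num [Complex.normSq_apply]]
      ring
    generalize (K.1 0 0).re = a at *
    generalize (K.1 1 1).re = d at *
    generalize (K.2 0 0).re = a' at *
    generalize (K.2 1 1).re = d' at *
    have e1 : a * d = k.re * k.re + k.im * k.im := by linarith
    have e2 : a' * d' = t ^ 4 * (k.re * k.re + k.im * k.im) := by linear_combination h22 / 2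
    have e3 : a * d' + d * a' = 1 - ‖2 * t * k‖ ^ 2 / 2 := by rw [hn]; linear_combination h12
    have e4 : (a * d') * (d * a') = (‖2 * t * k‖ ^ 2) ^ 2 / 16 := by
      rw [hn]; linear_combination a' * d' * e1 + (k.re * k.re + k.im * k.im) * e2
    -- With `n = ‖w‖²`, the numbers `a d'` and `d a'` have sum `1 - n/2` and product `n²/16`; AM–GM
    -- gives `n ≤ 1`.
    have e5 : ‖2 * t * k‖ ^ 2 ≤ 1 := by nlinarith [sq_nonneg (a * d' - d * a')]
    exact (sq_le_one_iff₀ (norm_nonneg _)).1 e5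
  · have e1 : Real.exp (s + R) = Real.exp s * Real.exp R := Real.exp_add _ _
    have e2 : Real.exp (-(s + R)) = Real.exp (-s) * t := by rw [ht, ← Real.exp_add, neg_add]
    simp only [geodesicLine, Matrix.add_apply, Matrix.smul_apply, smul_eq_mul]
    rw [h2, ← hk, Real.sinh_eq, e1, e2]
    push_cast [-Complex.ofReal_exp]
    linear_combination -(Real.exp s : ℂ) * k * httC

theorem geodesicLine_unique {K K' : Matrix (Fin 2) (Fin 2) ℂ × Matrix (Fin 2) (Fin 2) ℂ}
    {u w : ℝ} (huw : u ≠ w) (hu : geodesicLine K u = geodesicLine K' u)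
    (hw : geodesicLine K w = geodesicLine K' w) : K = K' := by
  have hne : ((Real.exp (u - w) - Real.exp (w - u) : ℝ) : ℂ) ≠ 0 := by
    rw [Complex.ofReal_ne_zero, sub_ne_zero, Real.exp_injective.ne_iff]
    intro h; apply huw; linarith
  have e1 : Real.exp (u - w) = Real.exp u * Real.exp (-w) := by rw [← Real.exp_add]; rfl
  have e2 : Real.exp (w - u) = Real.exp w * Real.exp (-u) := by rw [← Real.exp_add]; rfl
  rw [e1, e2] at hne
  push_cast at hne
  refine Prod.ext ?_ ?_ <;> ext i j <;>
    (have a := congrFun₂ hu i j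
     have b := congrFun₂ hw i j
     simp only [geodesicLine, Matrix.add_apply, Matrix.smul_apply, smul_eq_mul] at a b
     apply mul_left_cancel₀ hne
     push_cast at a b)
  · linear_combination Complex.exp (-w) * a - Complex.exp (-u) * b
  · linear_combination Complex.exp u * b - Complex.exp w * a

/-- Two points of the curve determine the null vectors. The form then gives the pairings of these
with every other point, and the error `c s - geodesicLine K s` is null and orthogonal to `c s`,
hence zero. -/
theorem eq_geodesicLine_of_dist {c : ℝ → H3} {J : Set ℝ} {u w : ℝ} (hu : u ∈ J) (hw : w ∈ J)
    (huw : u < w)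
    (h : ∀ s ∈ J, ∀ t ∈ J, detPolar (c s).1 (c t).1 = ((2 * Real.cosh (s - t) : ℝ) : ℂ)) :
    ∃ K : Matrix (Fin 2) (Fin 2) ℂ × Matrix (Fin 2) (Fin 2) ℂ,
      IsNullPair K ∧ ∀ s ∈ J, (c s).1 = geodesicLine K s := by
  have hS : 0 < 2 * Real.sinh (w - u) := by
    have : 0 < Real.sinh (w - u) := Real.sinh_pos_iff.2 (sub_pos.2 huw)
    linarith
  set S := 2 * Real.sinh (w - u) with hSdef
  have hSe : S = Real.exp w * Real.exp (-u) - Real.exp u * Real.exp (-w) := by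
    rw [hSdef, Real.sinh_eq, ← Real.exp_add, ← Real.exp_add,
      show -(w - u) = u + -w by ring, sub_eq_add_neg w u]
    ring
  have smulH : ∀ (x : ℝ) (A : Matrix (Fin 2) (Fin 2) ℂ), A.IsHermitian →
      ((x : ℂ) • A).IsHermitian := by
    intro x A hA
    rw [Matrix.IsHermitian, Matrix.conjTranspose_smul, hA.eq]
    simp
  have hcH : ∀ s, (c s).1.IsHermitian := fun s => (c s).2.1.isHermitian
  have hc : ∀ s ∈ J, ∀ t ∈ J, detPolar (c s).1 (c t).1 =
      ((Real.exp s * Real.exp (-t) + Real.exp (-s) * Real.exp t : ℝ) : ℂ) := by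
    intro x hx y hy
    rw [h x hx y hy, Real.cosh_eq, ← Real.exp_add, ← Real.exp_add, show -(x - y) = -x + y by ring,
      sub_eq_add_neg]
    congr 1; ring
  clear_value S
  have hS0 : S ≠ 0 := hS.ne'
  -- Solution of the linear system `geodesicLine K u = c u`, `geodesicLine K w = c w`, whose
  -- determinant is `S` up to sign.
  obtain ⟨K, hK1, hK2⟩ : ∃ K : Matrix (Fin 2) (Fin 2) ℂ × Matrix (Fin 2) (Fin 2) ℂ,
      K.1 = (S⁻¹ : ℝ) • ((Real.exp (-u) : ℂ) • (c w).1 + ((-Real.exp (-w) : ℝ) : ℂ) • (c u).1) ∧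
      K.2 = (S⁻¹ : ℝ) • ((Real.exp w : ℂ) • (c u).1 + ((-Real.exp u : ℝ) : ℂ) • (c w).1) :=
    ⟨(_, _), rfl, rfl⟩
  rw [← Complex.coe_smul] at hK1 hK2
  have hH1 : K.1.IsHermitian := by
    rw [hK1]; exact smulH _ _ ((smulH _ _ (hcH _)).add (smulH _ _ (hcH _)))
  have hH2 : K.2.IsHermitian := by
    rw [hK2]; exact smulH _ _ ((smulH _ _ (hcH _)).add (smulH _ _ (hcH _)))
  have k1 : ∀ s ∈ J, detPolar K.1 (c s).1 = (Real.exp (-s) : ℂ) := by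
    intro s hs
    rw [hK1]
    simp only [map_add, map_smul, LinearMap.add_apply, LinearMap.smul_apply, smul_eq_mul,
      hc w hw s hs, hc u hu s hs]
    norm_cast
    rw [inv_mul_eq_iff_eq_mul₀ hS0, hSe]
    ring
  have k2 : ∀ s ∈ J, detPolar K.2 (c s).1 = (Real.exp s : ℂ) := by
    intro s hs
    rw [hK2]
    simp only [map_add, map_smul, LinearMap.add_apply, LinearMap.smul_apply, smul_eq_mul,
      hc w hw s hs, hc u hu s hs]
    norm_cast
    rw [inv_mul_eq_iff_eq_mul₀ hS0, hSe]
    ring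
  have k11 : detPolar K.1 K.1 = 0 := by
    conv_lhs => arg 2; rw [hK1]
    simp only [map_add, map_smul, smul_eq_mul, k1 w hw, k1 u hu]
    norm_cast
    ring
  have k22 : detPolar K.2 K.2 = 0 := by
    conv_lhs => arg 2; rw [hK2]
    simp only [map_add, map_smul, smul_eq_mul, k2 w hw, k2 u hu]
    norm_cast
    ring
  have k12 : detPolar K.1 K.2 = 1 := by
    conv_lhs => arg 2; rw [hK2]
    simp only [map_add, map_smul, smul_eq_mul, k1 w hw, k1 u hu]
    norm_cast
    rw [inv_mul_eq_iff_eq_mul₀ hS0, hSe]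
    ring
  refine ⟨K, ⟨hH1, hH2, k11, k22, k12⟩, fun s hs => ?_⟩
  have k21 := detPolar_comm K.2 K.1
  rw [k12] at k21
  have k1' := detPolar_comm (c s).1 K.1
  have k2' := detPolar_comm (c s).1 K.2
  rw [k1 s hs] at k1'
  rw [k2 s hs] at k2'
  rw [← sub_eq_zero]
  have hcs := hc s hs s hs
  push_cast at hcs
  refine eq_zero_of_detPolar_H3 ((hcH s).sub ((smulH _ _ hH1).add (smulH _ _ hH2))) (c s) ?_ ?_
  · simp only [geodesicLine, map_add, map_sub, map_smul, LinearMap.add_apply, LinearMap.sub_apply,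
      LinearMap.smul_apply, smul_eq_mul, k1 s hs, k2 s hs, k1', k2', k11, k12, k21, k22, hcs]
    push_cast
    ring
  · simp only [geodesicLine, map_add, map_sub, map_smul, LinearMap.add_apply, LinearMap.sub_apply,
      LinearMap.smul_apply, smul_eq_mul, k1 s hs, k2 s hs, hcs]
    push_cast
    ring

/-- A curve parametrized locally by arc length as a shortest curve is a geodesic. -/
theorem exists_eq_geodesicLine {c : ℝ → H3} {R : ℝ} (hR : 0 < R)
    (h : ∀ s ∈ Ioo (-R) R, ∃ δ > 0, ∀ s₁ ∈ Ioo (-R) R, ∀ s₂ ∈ Ioo (-R) R,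
      |s₁ - s| < δ → |s₂ - s| < δ → (c s₁).dist (c s₂) = |s₁ - s₂|) :
    ∃ K : Matrix (Fin 2) (Fin 2) ℂ × Matrix (Fin 2) (Fin 2) ℂ,
      IsNullPair K ∧ ∀ s ∈ Ioo (-R) R, (c s).1 = geodesicLine K s := by
  have : PreconnectedSpace (Ioo (-R) R) := Subtype.preconnectedSpace isPreconnected_Ioo
  have : Nonempty (Ioo (-R) R) := ⟨⟨0, by simpa using hR⟩⟩
  have key := exists_global_parameter (T := Ioo (-R) R)
    (Par := {K : Matrix (Fin 2) (Fin 2) ℂ × Matrix (Fin 2) (Fin 2) ℂ // IsNullPair K})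
    (fun K t => geodesicLine K.1 t.1) (fun t => (c t.1).1) ?_ ?_
  · obtain ⟨⟨K, hK⟩, hc⟩ := key
    exact ⟨K, hK, fun s hs => hc ⟨s, hs⟩⟩
  · rintro ⟨s, hs⟩
    obtain ⟨δ, hδ, H⟩ := h s hs
    set η := min δ (R - s) / 2 with hη
    have hsR : 0 < R - s := sub_pos.2 hs.2
    have hη0 : 0 < η := by positivity
    have hη1 : η < δ := by
      have := min_le_left δ (R - s); rw [hη] at hη0 ⊢; linarith
    have hη2 : s + η < R := by
      have := min_le_right δ (R - s); rw [hη] at hη0 ⊢; linarith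
    obtain ⟨K, hK, hK6⟩ := eq_geodesicLine_of_dist
      (c := c) (J := {t | t ∈ Ioo (-R) R ∧ |t - s| < δ}) (u := s) (w := s + η)
      ⟨hs, by simpa using hδ⟩ ⟨⟨by linarith [hs.1], hη2⟩, by simpa [abs_of_pos hη0] using hη1⟩
      (by linarith) (by
        intro x hx y hy
        refine H3.detPolar_eq_of_dist (Real.one_le_cosh _) ?_
        rw [H x hx.1 y hy.1 hx.2 hy.2, ← Real.cosh_abs, Real.arcosh_cosh (abs_nonneg _)])
    refine ⟨⟨K, hK⟩, ?_⟩
    have : ∀ᶠ t : Ioo (-R) R in 𝓝 ⟨s, hs⟩, |t.1 - s| < δ := by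
      have hcont : Continuous fun t : Ioo (-R) R => |t.1 - s| := by fun_prop
      refine hcont.continuousAt.eventually_lt continuousAt_const ?_
      simpa using hδ
    filter_upwards [this] with t ht
    exact hK6 t.1 ⟨t.2, ht⟩
  · rintro ⟨s, hs⟩ K K' hKK
    rw [nhds_subtype_eq_comap, eventually_comap] at hKK
    have h2 : ∀ᶠ t in 𝓝 s, t ∈ Ioo (-R) R := isOpen_Ioo.mem_nhds hs
    obtain ⟨ε, hε, hball⟩ := Metric.eventually_nhds_iff.1 (hKK.and h2)
    have b1 := hball (y := s) (by simpa using hε)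
    have b2 := hball (y := s + ε / 2) (by
      rw [Real.dist_eq, add_sub_cancel_left, abs_of_pos (by linarith)]; linarith)
    exact Subtype.ext (geodesicLine_unique (u := s) (w := s + ε / 2) (by linarith)
      (b1.1 ⟨_, b1.2⟩ rfl) (b2.1 ⟨_, b2.2⟩ rfl))

/-! ### Cylindrical coordinates in hyperbolic space -/

/-- The point of hyperbolic space with cylindrical coordinates `(r, φ, z)`. -/
def cylMatrix (a : ℝ × ℝ × ℝ) : Matrix (Fin 2) (Fin 2) ℂ :=
  hermMatrix (Real.exp a.2.2 * Real.cosh a.1) (Real.exp (-a.2.2) * Real.cosh a.1)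
    (Real.sinh a.1 * (Real.cos a.2.1 + Real.sin a.2.1 * Complex.I))

/-- Half of this form is the expression inside `coneDist`, with the actual difference of angles in
place of its class modulo `θ`. -/
theorem detPolar_cylMatrix (a b : ℝ × ℝ × ℝ) : detPolar (cylMatrix a) (cylMatrix b) =
    ((2 * (Real.cosh a.1 * Real.cosh b.1 * Real.cosh (a.2.2 - b.2.2) -
      Real.sinh a.1 * Real.sinh b.1 * Real.cos (a.2.1 - b.2.1)) : ℝ) : ℂ) := by
  rw [cylMatrix, cylMatrix, detPolar_hermMatrix, Real.cos_sub, Real.cosh_eq (a.2.2 - b.2.2),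
    show -(a.2.2 - b.2.2) = -a.2.2 + b.2.2 by ring, sub_eq_add_neg a.2.2, Real.exp_add, Real.exp_add]
  simp
  ring

/-- The universal covering of the tube of radius `R` without its core, in cylindrical coordinates. -/
def tubeCover (R : ℝ) : Set (ℝ × ℝ × ℝ) := {a | 0 < a.1 ∧ a.1 < R}

theorem isOpen_tubeCover (R : ℝ) : IsOpen (tubeCover R) :=
  (isOpen_lt continuous_const continuous_fst).inter (isOpen_lt continuous_fst continuous_const)

theorem convex_tubeCover (R : ℝ) : Convex ℝ (tubeCover R) :=
  (convex_halfSpace_gt (f := fun a : ℝ × ℝ × ℝ => a.1) (IsLinearMap.mk (by simp) (by simp)) 0).inter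
    (convex_halfSpace_lt (f := fun a : ℝ × ℝ × ℝ => a.1) (IsLinearMap.mk (by simp) (by simp)) R)

/-- Off the axis, a germ of the parametrization already spans all matrices, so a linear map is
determined by its germ. A functional vanishing near `a` is tested at the point and at its
displacements by `±δ` in `φ` and in `z`. -/
theorem span_cylMatrix_eq_top {a : ℝ × ℝ × ℝ} (ha : 0 < a.1) {W : Set (ℝ × ℝ × ℝ)}
    (hW : W ∈ 𝓝 a) : Submodule.span ℂ (cylMatrix '' W) = ⊤ := by
  obtain ⟨r, φ, z⟩ := a
  simp only at ha
  by_contra hne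
  obtain ⟨l, hl0, hl⟩ := Submodule.exists_le_ker_of_lt_top _ (lt_top_iff_ne_top.2 hne)
  apply hl0
  obtain ⟨ε, hε, hball⟩ := Metric.mem_nhds_iff.1 hW
  -- `δ < 1 < π` makes `sin δ` nonzero, and therefore `cos δ ≠ 1`.
  set δ := min ε 1 / 2 with hδ
  have hδ0 : 0 < δ := by positivity
  have hδε : δ < ε := by have := min_le_left ε 1; rw [hδ]; linarith
  have hδ1 : δ < 1 := by have := min_le_right ε 1; rw [hδ]; linarith
  set p := l (Matrix.single 0 0 1)
  set q := l (Matrix.single 1 1 1)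
  set x := l (Matrix.single 0 1 1)
  set y := l (Matrix.single 1 0 1)
  have hexp : ∀ A : Matrix (Fin 2) (Fin 2) ℂ,
      l A = A 0 0 * p + A 1 1 * q + A 0 1 * x + A 1 0 * y := by
    intro A
    have : A = A 0 0 • Matrix.single 0 0 1 + A 1 1 • Matrix.single 1 1 1 +
        A 0 1 • Matrix.single 0 1 1 + A 1 0 • Matrix.single 1 0 1 := by
      ext i j
      fin_cases i <;> fin_cases j <;> simp
    conv_lhs => rw [this]
    simp only [map_add, map_smul, smul_eq_mul]
    rfl
  have hval : ∀ u v : ℝ, |u| < ε → |v| < ε → l (cylMatrix (r, φ + u, z + v)) = 0 := by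
    intro u v hu hv
    apply hl
    apply Submodule.subset_span
    refine mem_image_of_mem _ (hball ?_)
    simp [Prod.dist_eq, hu, hv]
  have habs : |δ| < ε := by rwa [abs_of_pos hδ0]
  have habs' : |-δ| < ε := by rwa [abs_neg]
  have h0 : |(0 : ℝ)| < ε := by simpa using hε
  have e0 := hval 0 0 h0 h0
  have e1 := hval 0 δ h0 habs
  have e2 := hval 0 (-δ) h0 habs'
  have e3 := hval δ 0 habs h0
  have e4 := hval (-δ) 0 habs' h0
  have hcosh : Real.cosh δ - 1 ≠ 0 := (sub_pos.2 (Real.one_lt_cosh.2 hδ0.ne')).ne'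
  have hsinh : Real.sinh δ ≠ 0 := (Real.sinh_pos_iff.2 hδ0).ne'
  have hsin : Real.sin δ ≠ 0 :=
    (Real.sin_pos_of_pos_of_lt_pi hδ0 (by linarith [Real.pi_gt_three])).ne'
  have hcos : Real.cos δ - 1 ≠ 0 := by
    intro h
    have h1 := Real.sin_sq_add_cos_sq δ
    rw [sub_eq_zero.1 h] at h1
    exact hsin (by nlinarith)
  have hr : Real.sinh r ≠ 0 := (Real.sinh_pos_iff.2 ha).ne'
  have hrc : Real.cosh r ≠ 0 := (Real.cosh_pos r).ne'
  have hexpz : Real.exp z * Real.exp (-z) = 1 := by rw [← Real.exp_add]; simp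
  have hexpd : Real.exp δ = Real.cosh δ + Real.sinh δ := (Real.cosh_add_sinh δ).symm
  have hexpd' : Real.exp (-δ) = Real.cosh δ - Real.sinh δ := (Real.cosh_sub_sinh δ).symm
  simp only [hexp, cylMatrix, hermMatrix, Matrix.of_apply, Matrix.cons_val', Matrix.cons_val_zero,
    Matrix.cons_val_one, Matrix.cons_val_fin_one, star_mul', star_add, Complex.star_def,
    Complex.conj_ofReal, Complex.conj_I, add_zero, Real.cos_add, Real.sin_add, Real.cos_neg,
    Real.sin_neg, neg_add, neg_neg, Real.exp_add, hexpd, hexpd'] at e0 e1 e2 e3 e4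
  rw [← Complex.ofReal_ne_zero] at hcosh hsinh hsin hcos hr hrc
  push_cast at e0 e1 e2 e3 e4 hcosh hsinh hsin hcos hr hrc
  have hexpzC : Complex.exp z * Complex.exp (-z) = 1 := by rw [← Complex.exp_add]; simp
  have hpyth := Complex.sin_sq_add_cos_sq (φ : ℂ)
  -- Even and odd parts of the displacements in `z` isolate the diagonal coefficients; those in `φ`
  -- isolate the off-diagonal ones.
  have a1 : Complex.exp z * p + Complex.exp (-z) * q = 0 := by
    apply mul_left_cancel₀ hcosh; apply mul_left_cancel₀ hrc
    linear_combination (e1 + e2) / 2 - e0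
  have a2 : Complex.exp z * p - Complex.exp (-z) * q = 0 := by
    apply mul_left_cancel₀ hsinh; apply mul_left_cancel₀ hrc
    linear_combination (e1 - e2) / 2
  have a3 : (Complex.cos φ + Complex.sin φ * Complex.I) * x +
      (Complex.cos φ - Complex.sin φ * Complex.I) * y = 0 := by
    apply mul_left_cancel₀ hcos; apply mul_left_cancel₀ hr
    linear_combination (e3 + e4) / 2 - e0
  have a4 : (Complex.cos φ + Complex.sin φ * Complex.I) * x -
      (Complex.cos φ - Complex.sin φ * Complex.I) * y = 0 := by
    have : Complex.I * ((Complex.cos φ + Complex.sin φ * Complex.I) * x -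
        (Complex.cos φ - Complex.sin φ * Complex.I) * y) = 0 := by
      apply mul_left_cancel₀ hsin; apply mul_left_cancel₀ hr
      linear_combination (e3 - e4) / 2 + Complex.sinh r * Complex.sin δ * Complex.sin φ * (x + y) *
        Complex.I_sq
    exact (mul_eq_zero.1 this).resolve_left Complex.I_ne_zero
  have hp : p = 0 := by
    linear_combination Complex.exp (-z) * (a1 + a2) / 2 - p * hexpzC
  have hq : q = 0 := by
    linear_combination Complex.exp z * (a1 - a2) / 2 - q * hexpzC
  have hx : x = 0 := by
    linear_combination (Complex.cos φ - Complex.sin φ * Complex.I) * (a3 + a4) / 2 - x * hpyth +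
      Complex.sin φ ^ 2 * x * Complex.I_sq
  have hy : y = 0 := by
    linear_combination (Complex.cos φ + Complex.sin φ * Complex.I) * (a3 - a4) / 2 - y * hpyth +
      Complex.sin φ ^ 2 * y * Complex.I_sq
  ext1 A
  rw [hexp, hp, hq, hx, hy]; simp

/-- Two families with the same Gram matrix, one of which spans, are related by a linear map. -/
theorem exists_linearMap_of_gram {ι : Type*} {D E : ι → Matrix (Fin 2) (Fin 2) ℂ}
    (hD : Submodule.span ℂ (range D) = ⊤)
    (h : ∀ i j, detPolar (E i) (E j) = detPolar (D i) (D j)) :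
    ∃ g : Matrix (Fin 2) (Fin 2) ℂ →ₗ[ℂ] Matrix (Fin 2) (Fin 2) ℂ, ∀ i, g (D i) = E i := by
  let T : Matrix (Fin 2) (Fin 2) ℂ →ₗ[ℂ] (ι → ℂ) :=
    LinearMap.pi fun i => detPolar.flip (D i)
  let S : Matrix (Fin 2) (Fin 2) ℂ →ₗ[ℂ] (ι → ℂ) :=
    LinearMap.pi fun i => detPolar.flip (E i)
  have hTS : ∀ i, T (D i) = S (E i) := fun i => funext fun j => (h i j).symm
  have hT : Function.Injective T := by
    rw [injective_iff_map_eq_zero]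
    intro A hA
    refine eq_zero_of_detPolar_eq_zero fun B => ?_
    have : detPolar A = 0 := LinearMap.ext_on hD (by
      rintro _ ⟨i, rfl⟩
      exact congrFun hA i)
    rw [this]; rfl
  -- `T` and `S` record the pairings with the two families. Since `T` is injective with range inside
  -- that of `S`, a dimension count makes `S` injective too, and the map sought is `S⁻¹ ∘ T`.
  have hrange : LinearMap.range T ≤ LinearMap.range S := by
    rw [LinearMap.range_eq_map, ← hD, Submodule.map_span, Submodule.span_le]
    rintro _ ⟨_, ⟨i, rfl⟩, rfl⟩
    exact ⟨E i, (hTS i).symm⟩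
  have hS : Function.Injective S := by
    rw [← LinearMap.ker_eq_bot]
    have h1 := LinearMap.finrank_range_add_finrank_ker S
    have h2 := LinearMap.finrank_range_of_inj hT
    have h3 := Submodule.finrank_mono hrange
    apply Submodule.finrank_eq_zero.1
    omega
  refine ⟨(LinearEquiv.ofInjective S hS).symm.toLinearMap ∘ₗ
    T.codRestrict (LinearMap.range S) fun A => hrange ⟨A, rfl⟩, fun i => ?_⟩
  rw [LinearMap.comp_apply, LinearEquiv.coe_coe, LinearEquiv.symm_apply_eq]
  exact Subtype.ext (hTS i)

/-- A local isometry of the universal covering of a tube is the restriction of a linear map. -/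
theorem exists_linearMap_of_localIsometry {R : ℝ} (hR : 0 < R) {E : tubeCover R → H3}
    (hE : ∀ y, ∃ W ∈ 𝓝 y, ∀ b ∈ W, ∀ c ∈ W,
      detPolar (E b).1 (E c).1 = detPolar (cylMatrix b) (cylMatrix c)) :
    ∃ g : Matrix (Fin 2) (Fin 2) ℂ →ₗ[ℂ] Matrix (Fin 2) (Fin 2) ℂ,
      (∀ y, (E y).1 = g (cylMatrix y)) ∧ ∀ A B, detPolar (g A) (g B) = detPolar A B := by
  have : Nonempty (tubeCover R) := ⟨⟨(R / 2, 0, 0), by simp [tubeCover, hR]⟩⟩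
  have : PreconnectedSpace (tubeCover R) :=
    Subtype.preconnectedSpace (convex_tubeCover R).isPreconnected
  have hspan : ∀ (y : tubeCover R) (W : Set (tubeCover R)), W ∈ 𝓝 y →
      Submodule.span ℂ (range fun b : W => cylMatrix b) = ⊤ := by
    intro y W hW
    have h1 : Subtype.val '' W ∈ 𝓝 y.1 :=
      (isOpen_tubeCover R).isOpenMap_subtype_val.image_mem_nhds hW
    have h2 := span_cylMatrix_eq_top y.2.1 h1
    rw [← h2, image_image]
    congr 1
    ext A; simp
  obtain ⟨g, hg⟩ := exists_global_parameter
    (Par := Matrix (Fin 2) (Fin 2) ℂ →ₗ[ℂ] Matrix (Fin 2) (Fin 2) ℂ)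
    (fun g (y : tubeCover R) => g (cylMatrix y)) (fun y => (E y).1) (by
      intro y
      obtain ⟨W, hW, h⟩ := hE y
      obtain ⟨g, hg⟩ := exists_linearMap_of_gram (hspan y W hW) (E := fun b : W => (E b).1)
        (fun b c => h b b.2 c c.2)
      exact ⟨g, by filter_upwards [hW] with b hb using (hg ⟨b, hb⟩).symm⟩) (by
      intro y g g' h
      refine LinearMap.ext_on (hspan y _ h) ?_
      rintro _ ⟨b, rfl⟩
      exact b.2)
  refine ⟨g, hg, ?_⟩
  obtain ⟨y⟩ := ‹Nonempty (tubeCover R)›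
  obtain ⟨W, hW, h⟩ := hE y
  have : detPolar.compl₁₂ g g = detPolar := by
    refine LinearMap.ext_on (hspan y W hW) ?_
    rintro _ ⟨b, rfl⟩
    refine LinearMap.ext_on (hspan y W hW) ?_
    rintro _ ⟨c, rfl⟩
    have := h b b.2 c c.2
    rw [hg, hg] at this
    exact this
  intro A B
  exact congrArg (fun f => f A B) this

theorem mul_single_mul_conjTranspose_apply (g : Matrix (Fin 2) (Fin 2) ℂ) (k i j : Fin 2) :
    (g * Matrix.single k k (1 : ℂ) * g.conjTranspose) i j = g i k * star (g j k) := by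
  fin_cases k <;> simp [Matrix.mul_apply, Fin.sum_univ_two, Matrix.single_apply]

/-- Two orthonormalized null vectors on the light cone are the ends of a geodesic. -/
theorem exists_SL2_of_null {P Q : Matrix (Fin 2) (Fin 2) ℂ}
    (hP : P.IsHermitian) (hP0 : 0 ≤ (P 0 0).re) (hP1 : 0 ≤ (P 1 1).re) (hPP : detPolar P P = 0)
    (hQ : Q.IsHermitian) (hQ0 : 0 ≤ (Q 0 0).re) (hQ1 : 0 ≤ (Q 1 1).re) (hQQ : detPolar Q Q = 0)
    (hPQ : detPolar P Q = 1) :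
    ∃ h : SL(2, ℂ), h.1 * Matrix.single 0 0 1 * h.1.conjTranspose = P ∧
      h.1 * Matrix.single 1 1 1 * h.1.conjTranspose = Q := by
  -- A null Hermitian matrix in the closed forward cone has rank at most one: it is `v vᴴ`.
  have key : ∀ P : Matrix (Fin 2) (Fin 2) ℂ, P.IsHermitian → 0 ≤ (P 0 0).re → 0 ≤ (P 1 1).re →
      detPolar P P = 0 → ∃ v : Fin 2 → ℂ, ∀ i j, P i j = v i * star (v j) := by
    intro P hP hP0 hP1 hPP
    have hPe := exists_hermMatrix hP
    generalize (P 0 0).re = p at *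
    generalize (P 1 1).re = s at *
    generalize P 0 1 = q at *
    subst hPe
    rw [detPolar_hermMatrix, Complex.ofReal_eq_zero] at hPP
    have hps : p * s = q.re * q.re + q.im * q.im := by linarith
    rcases hP0.eq_or_lt with h | h
    · have hq1 : q.re = 0 := by rw [← h] at hps; nlinarith [sq_nonneg q.re, sq_nonneg q.im]
      have hq2 : q.im = 0 := by rw [← h] at hps; nlinarith [sq_nonneg q.re, sq_nonneg q.im]
      have hq : q = 0 := Complex.ext hq1 hq2
      refine ⟨![0, (Real.sqrt s : ℂ)], fun i j => ?_⟩
      have : (Real.sqrt s : ℂ) * Real.sqrt s = s := by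
        rw [← Complex.ofReal_mul, Real.mul_self_sqrt hP1]
      fin_cases i <;> fin_cases j <;> simp [hermMatrix, hq, ← h, this]
    · have h1 : (Real.sqrt p : ℂ) * Real.sqrt p = p := by
        rw [← Complex.ofReal_mul, Real.mul_self_sqrt hP0]
      have h0 : (Real.sqrt p : ℂ) ≠ 0 := by
        rw [Complex.ofReal_ne_zero]; exact (Real.sqrt_pos.2 h).ne'
      have hqq : (p : ℂ) * s = star q * q := by
        rw [Complex.star_def, ← Complex.normSq_eq_conj_mul_self, Complex.normSq_apply, ← hps]
        push_cast; ring
      refine ⟨![(Real.sqrt p : ℂ), star q / Real.sqrt p], fun i j => ?_⟩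
      fin_cases i <;> fin_cases j <;> simp [hermMatrix, h1]
      · field_simp
      · field_simp
      · rw [div_mul_div_comm, h1, eq_div_iff (by simpa using h.ne')]
        simp only [Complex.star_def] at hqq
        linear_combination hqq
  obtain ⟨v, hv⟩ := key P hP hP0 hP1 hPP
  obtain ⟨w, hw⟩ := key Q hQ hQ0 hQ1 hQQ
  set d := v 0 * w 1 - v 1 * w 0 with hd
  have hdd : d * star d = 1 := by
    rw [← hPQ, detPolar_apply, hv, hv, hv, hv, hw, hw, hw, hw, hd]
    simp only [star_sub, star_mul']
    ring
  -- The pairing of `v vᴴ` and `w wᴴ` is `|d|²`, which is 1. Multiplying `w` by the unit number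
  -- `star d` turns the determinant into 1 and leaves `w wᴴ` unchanged.
  refine ⟨⟨!![v 0, star d * w 0; v 1, star d * w 1], ?_⟩, ?_, ?_⟩
  · rw [Matrix.det_fin_two_of]
    linear_combination hdd
  · ext i j
    rw [hv, mul_single_mul_conjTranspose_apply]
    fin_cases i <;> fin_cases j <;> simp
  · ext i j
    rw [hw, mul_single_mul_conjTranspose_apply]
    simp only [Complex.star_def] at hdd
    fin_cases i <;> fin_cases j <;> simp
    · linear_combination w 0 * starRingEnd ℂ (w 0) * hdd
    · linear_combination w 0 * starRingEnd ℂ (w 1) * hdd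
    · linear_combination w 1 * starRingEnd ℂ (w 0) * hdd
    · linear_combination w 1 * starRingEnd ℂ (w 1) * hdd

/-- The ends of the axis are limits of rescaled points of the tube. So their images are in the
closed forward cone, which the preservation of the form alone would not give. -/
theorem tendsto_exp_smul_cylMatrix_atTop (r φ : ℝ) :
    Tendsto (fun z : ℝ => (Real.exp (-z) : ℂ) • cylMatrix (r, φ, z)) atTop
      (𝓝 ((Real.cosh r : ℂ) • Matrix.single 0 0 1)) := by
  have h0 : Tendsto (fun z : ℝ => (Real.exp (-z) : ℂ)) atTop (𝓝 0) := by
    have := (Complex.continuous_ofReal.tendsto 0).comp Real.tendsto_exp_neg_atTop_nhds_zero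
    simpa only [Function.comp_def, Complex.ofReal_zero] using this
  have hexp : ∀ z : ℝ, (Real.exp (-z) : ℂ) * Real.exp z = 1 := by
    intro z; rw [← Complex.ofReal_mul, ← Real.exp_add]; simp
  refine tendsto_pi_nhds.2 fun i => tendsto_pi_nhds.2 fun j => ?_
  fin_cases i <;> fin_cases j
  · refine Tendsto.congr (f₁ := fun _ => (Real.cosh r : ℂ)) (fun z => ?_) ?_
    · simp only [cylMatrix, hermMatrix, Matrix.smul_apply, smul_eq_mul]
      simp only [Fin.zero_eta, Matrix.of_apply, Matrix.cons_val_zero, Complex.ofReal_mul]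
      rw [← mul_assoc, hexp, one_mul]
    · simp
  · have := h0.mul_const (cylMatrix (r, φ, 0) 0 1)
    rw [zero_mul] at this
    simpa [cylMatrix, hermMatrix] using this
  · have := h0.mul_const (cylMatrix (r, φ, 0) 1 0)
    rw [zero_mul] at this
    simpa [cylMatrix, hermMatrix] using this
  · have := (h0.mul h0).mul_const (Real.cosh r : ℂ)
    rw [zero_mul, zero_mul] at this
    simp only [Fin.mk_one, cylMatrix, hermMatrix, Matrix.smul_apply, smul_eq_mul, Matrix.of_apply,
      Matrix.cons_val_one, Complex.ofReal_mul, Matrix.cons_val_fin_one]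
    simpa [mul_assoc] using this

theorem tendsto_exp_smul_cylMatrix_atBot (r φ : ℝ) :
    Tendsto (fun z : ℝ => (Real.exp (-z) : ℂ) • cylMatrix (r, φ, -z)) atTop
      (𝓝 ((Real.cosh r : ℂ) • Matrix.single 1 1 1)) := by
  have h0 : Tendsto (fun z : ℝ => (Real.exp (-z) : ℂ)) atTop (𝓝 0) := by
    have := (Complex.continuous_ofReal.tendsto 0).comp Real.tendsto_exp_neg_atTop_nhds_zero
    simpa only [Function.comp_def, Complex.ofReal_zero] using this
  have hexp : ∀ z : ℝ, (Real.exp (-z) : ℂ) * Real.exp z = 1 := by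
    intro z; rw [← Complex.ofReal_mul, ← Real.exp_add]; simp
  refine tendsto_pi_nhds.2 fun i => tendsto_pi_nhds.2 fun j => ?_
  fin_cases i <;> fin_cases j
  · have := (h0.mul h0).mul_const (Real.cosh r : ℂ)
    rw [zero_mul, zero_mul] at this
    simp only [Fin.zero_eta, cylMatrix, hermMatrix, Matrix.smul_apply, smul_eq_mul, Matrix.of_apply,
      Matrix.cons_val_zero, Complex.ofReal_mul]
    simpa [mul_assoc] using this
  · have := h0.mul_const (cylMatrix (r, φ, 0) 0 1)
    rw [zero_mul] at this
    simpa [cylMatrix, hermMatrix] using this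
  · have := h0.mul_const (cylMatrix (r, φ, 0) 1 0)
    rw [zero_mul] at this
    simpa [cylMatrix, hermMatrix] using this
  · refine Tendsto.congr (f₁ := fun _ => (Real.cosh r : ℂ)) (fun z => ?_) ?_
    · simp only [Fin.mk_one, cylMatrix, hermMatrix, Matrix.smul_apply, smul_eq_mul]
      simp only [Matrix.of_apply, Matrix.cons_val_one, Complex.ofReal_mul, neg_neg,
        Matrix.cons_val_fin_one]
      rw [← mul_assoc, hexp, one_mul]
    · simp

/-- A limit of positive multiples of points of hyperbolic space is in the closed light cone. -/
theorem isHermitian_of_tendsto {c : ℝ → H3} {t : ℝ → ℝ} (ht : ∀ z, 0 < t z) {k : ℝ} (hk : 0 < k)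
    {P : Matrix (Fin 2) (Fin 2) ℂ}
    (h : Tendsto (fun z => (t z : ℂ) • (c z).1) atTop (𝓝 ((k : ℂ) • P))) :
    P.IsHermitian ∧ 0 ≤ (P 0 0).re ∧ 0 ≤ (P 1 1).re := by
  have hP : Tendsto (fun z => ((k⁻¹ * t z : ℝ) : ℂ) • (c z).1) atTop (𝓝 P) := by
    have := h.const_smul ((k⁻¹ : ℝ) : ℂ)
    simp only [smul_smul, ← Complex.ofReal_mul, inv_mul_cancel₀ hk.ne', Complex.ofReal_one,
      one_smul] at this
    exact this
  have hdiag : ∀ i, 0 ≤ (P i i).re := by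
    intro i
    have h1 : Tendsto (fun z => (((k⁻¹ * t z : ℝ) : ℂ) • (c z).1) i i) atTop (𝓝 (P i i)) :=
      tendsto_pi_nhds.1 (tendsto_pi_nhds.1 hP i) i
    have h2 := (Complex.continuous_re.tendsto _).comp h1
    refine ge_of_tendsto' h2 fun z => ?_
    have := (c z).diag_pos i
    have := ht z
    simp only [Function.comp, Matrix.smul_apply, smul_eq_mul, Complex.re_ofReal_mul]
    positivity
  refine ⟨?_, hdiag 0, hdiag 1⟩
  have h1 : Tendsto (fun z => (((k⁻¹ * t z : ℝ) : ℂ) • (c z).1).conjTranspose) atTop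
      (𝓝 P.conjTranspose) :=
    ((continuous_id.matrix_conjTranspose).tendsto P).comp hP
  refine tendsto_nhds_unique (h1.congr fun z => ?_) hP
  rw [Matrix.conjTranspose_smul, (c z).2.1.isHermitian.eq]
  simp

/-- Up to an element of `SL(2, ℂ)`, a local isometry of the universal covering of a tube preserves
the distance from the axis and the coordinate along it. -/
theorem exists_cylindrical_frame {R : ℝ} (hR : 0 < R) {E : tubeCover R → H3}
    (hE : ∀ y, ∃ W ∈ 𝓝 y, ∀ b ∈ W, ∀ c ∈ W,
      detPolar (E b).1 (E c).1 = detPolar (cylMatrix b) (cylMatrix c)) :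
    ∃ (h : SL(2, ℂ)) (χ : ℝ → ℂ), (∀ φ, ‖χ φ‖ = 1) ∧ ∀ y : tubeCover R,
      (h⁻¹ • E y).1 = hermMatrix (Real.exp y.1.2.2 * Real.cosh y.1.1)
        (Real.exp (-y.1.2.2) * Real.cosh y.1.1) (Real.sinh y.1.1 * χ y.1.2.1) := by
  obtain ⟨g, hg, hgg⟩ := exists_linearMap_of_localIsometry hR hE
  have hmem : ∀ φ z : ℝ, (R / 2, φ, z) ∈ tubeCover R := fun φ z => by simp [tubeCover, hR]
  have gcont : Continuous g := g.continuous_of_finiteDimensional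
  have hP := isHermitian_of_tendsto (c := fun z => E ⟨_, hmem 0 z⟩) (t := fun z => Real.exp (-z))
    (fun z => Real.exp_pos _) (k := Real.cosh (R / 2)) (Real.cosh_pos _)
    (P := g (Matrix.single 0 0 1)) (by
      have := (gcont.tendsto _).comp (tendsto_exp_smul_cylMatrix_atTop (R / 2) 0)
      simp only [Function.comp_def, map_smul] at this
      simpa only [hg] using this)
  have hQ := isHermitian_of_tendsto (c := fun z => E ⟨_, hmem 0 (-z)⟩) (t := fun z => Real.exp (-z))
    (fun z => Real.exp_pos _) (k := Real.cosh (R / 2)) (Real.cosh_pos _)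
    (P := g (Matrix.single 1 1 1)) (by
      have := (gcont.tendsto _).comp (tendsto_exp_smul_cylMatrix_atBot (R / 2) 0)
      simp only [Function.comp_def, map_smul] at this
      simpa only [hg] using this)
  obtain ⟨h, h1, h2⟩ := exists_SL2_of_null hP.1 hP.2.1 hP.2.2
    (by rw [hgg]; simp [detPolar_apply]) hQ.1 hQ.2.1 hQ.2.2
    (by rw [hgg]; simp [detPolar_apply]) (by rw [hgg]; simp [detPolar_apply])
  let g' : Matrix (Fin 2) (Fin 2) ℂ →ₗ[ℂ] Matrix (Fin 2) (Fin 2) ℂ :=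
    (LinearMap.mulLeft ℂ h⁻¹.1) ∘ₗ (LinearMap.mulRight ℂ h⁻¹.1.conjTranspose) ∘ₗ g
  have hg' : ∀ A, g' A = h⁻¹.1 * g A * h⁻¹.1.conjTranspose := fun A => by
    simp [g', Matrix.mul_assoc]
  have hhinv : h⁻¹.1 * h.1 = 1 := congrArg Subtype.val (inv_mul_cancel h)
  have hhinv' : h.1.conjTranspose * h⁻¹.1.conjTranspose = 1 := by
    rw [← Matrix.conjTranspose_mul, hhinv, Matrix.conjTranspose_one]
  have hcancel : ∀ A, h⁻¹.1 * (h.1 * A * h.1.conjTranspose) * h⁻¹.1.conjTranspose = A := by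
    intro A
    calc _ = (h⁻¹.1 * h.1) * A * (h.1.conjTranspose * h⁻¹.1.conjTranspose) := by
          simp only [Matrix.mul_assoc]
      _ = A := by rw [hhinv, hhinv', Matrix.one_mul, Matrix.mul_one]
  have hg'1 : g' (Matrix.single 0 0 1) = Matrix.single 0 0 1 := by rw [hg', ← h1, hcancel]
  have hg'2 : g' (Matrix.single 1 1 1) = Matrix.single 1 1 1 := by rw [hg', ← h2, hcancel]
  have hg'g : ∀ A B, detPolar (g' A) (g' B) = detPolar A B := by
    intro A B; rw [hg', hg', detPolar_smul_smul _ _ _ h⁻¹.2, hgg]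
  have hE' : ∀ y, (h⁻¹ • E y).1 = g' (cylMatrix y) := by
    intro y; rw [H3.coe_smul, hg, hg']
  -- The diagonal entries are the pairings with the two ends, which `g'` fixes.
  have h00 : ∀ A, (g' A) 0 0 = A 0 0 := by
    intro A
    have := hg'g A (Matrix.single 1 1 1)
    rw [hg'2] at this
    simpa [detPolar_apply] using this
  have h11 : ∀ A, (g' A) 1 1 = A 1 1 := by
    intro A
    have := hg'g A (Matrix.single 0 0 1)
    rw [hg'1] at this
    simpa [detPolar_apply] using this
  -- The local isometry may reverse orientation, so the angle may be reflected as well as rotated.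
  -- Only `‖χ φ‖ = 1` is kept, and it follows from the determinant being 1.
  let χ : ℝ → ℂ := fun φ =>
    (g' (hermMatrix 0 0 (Real.cos φ + Real.sin φ * Complex.I))) 0 1
  have hform : ∀ y : tubeCover R,
      (h⁻¹ • E y).1 = hermMatrix (Real.exp y.1.2.2 * Real.cosh y.1.1)
        (Real.exp (-y.1.2.2) * Real.cosh y.1.1) (Real.sinh y.1.1 * χ y.1.2.1) := by
    intro y
    have e00 := h00 (cylMatrix y)
    have e11 := h11 (cylMatrix y)
    rw [← hE' y] at e00 e11
    have e01 : (h⁻¹ • E y).1 0 1 = Real.sinh y.1.1 * χ y.1.2.1 := by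
      have : cylMatrix y.1 = ((Real.exp y.1.2.2 * Real.cosh y.1.1 : ℝ) : ℂ) • Matrix.single 0 0 1 +
          ((Real.exp (-y.1.2.2) * Real.cosh y.1.1 : ℝ) : ℂ) • Matrix.single 1 1 1 +
          (Real.sinh y.1.1 : ℂ) • hermMatrix 0 0 (Real.cos y.1.2.1 + Real.sin y.1.2.1 * Complex.I) := by
        ext i j
        fin_cases i <;> fin_cases j <;>
          simp [cylMatrix, hermMatrix, -Complex.ofReal_sinh, -Complex.ofReal_cos, -Complex.ofReal_sin]
      rw [hE', this, map_add, map_add, map_smul, map_smul, map_smul, hg'1, hg'2]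
      simp [χ]
    rw [exists_hermMatrix (h⁻¹ • E y).2.1.isHermitian, e01, e00, e11]
    rfl
  refine ⟨h, χ, fun φ => ?_, hform⟩
  have hy := (h⁻¹ • E ⟨_, hmem φ 0⟩).det_entries
  rw [hform] at hy
  have hs : Real.sinh (R / 2) ≠ 0 := (Real.sinh_pos_iff.2 (by linarith)).ne'
  simp only [hermMatrix, Matrix.of_apply, Matrix.cons_val', Matrix.cons_val_zero,
    Matrix.cons_val_one, Matrix.cons_val_fin_one, Complex.ofReal_re, Complex.normSq_eq_norm_sq,
    norm_mul, Complex.norm_real, neg_zero, Real.exp_zero, one_mul, mul_pow, Real.norm_eq_abs,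
    sq_abs] at hy
  have h3 : Real.sinh (R / 2) ^ 2 * (‖χ φ‖ ^ 2 - 1) = 0 := by
    linear_combination -hy + Real.cosh_sq (R / 2)
  have h4 : ‖χ φ‖ ^ 2 = 1 := by
    rcases mul_eq_zero.1 h3 with h | h
    · exact absurd (pow_eq_zero_iff two_ne_zero |>.1 h) hs
    · linarith
  exact (pow_eq_one_iff_of_nonneg (norm_nonneg _) two_ne_zero).1 h4

/-! ### Traces and the distance between two axes -/

/-- `g` preserves the geodesic from `0` to `∞` and its ends. -/
def FixesAxis (g : SL(2, ℂ)) : Prop := g.1 0 1 = 0 ∧ g.1 1 0 = 0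

/-- The hyperbolic cosine of the distance between the geodesic from `0` to `∞` and its image. -/
def axisCosh (g : SL(2, ℂ)) : ℝ := ‖g.1 0 0 * g.1 1 1‖ + ‖g.1 0 1 * g.1 1 0‖

theorem det_entries (g : SL(2, ℂ)) : g.1 0 0 * g.1 1 1 - g.1 0 1 * g.1 1 0 = 1 := by
  rw [← Matrix.det_fin_two, g.2]

theorem coe_inv_SL2 (g : SL(2, ℂ)) : g⁻¹.1 = !![g.1 1 1, -g.1 0 1; -g.1 1 0, g.1 0 0] := by
  rw [Matrix.SpecialLinearGroup.coe_inv, Matrix.adjugate_fin_two]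

theorem axisCosh_inv (g : SL(2, ℂ)) : axisCosh g⁻¹ = axisCosh g := by
  unfold axisCosh
  rw [coe_inv_SL2]
  simp [mul_comm]

theorem FixesAxis.det_eq {g : SL(2, ℂ)} (hg : FixesAxis g) : g.1 0 0 * g.1 1 1 = 1 := by
  have := det_entries g
  rwa [hg.1, zero_mul, sub_zero] at this

/-- A factor `diag(λ, λ⁻¹)` scales the two rows inversely, so `ad` and `bc` are unchanged. With the
versions for columns and for inverses, this makes `axisCosh` constant on tie classes. -/
theorem axisCosh_mul_left {g : SL(2, ℂ)} (hg : FixesAxis g) (A : SL(2, ℂ)) :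
    axisCosh (g * A) = axisCosh A := by
  have h := hg.det_eq
  obtain ⟨h0, h1⟩ := hg
  unfold axisCosh
  congr 2
  · simp only [Matrix.SpecialLinearGroup.coe_mul, Matrix.mul_apply, Fin.sum_univ_two, h0, h1]
    linear_combination A.1 0 0 * A.1 1 1 * h
  · simp only [Matrix.SpecialLinearGroup.coe_mul, Matrix.mul_apply, Fin.sum_univ_two, h0, h1]
    linear_combination A.1 0 1 * A.1 1 0 * h

theorem axisCosh_mul_right {g : SL(2, ℂ)} (hg : FixesAxis g) (A : SL(2, ℂ)) :
    axisCosh (A * g) = axisCosh A := by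
  have h := hg.det_eq
  obtain ⟨h0, h1⟩ := hg
  unfold axisCosh
  congr 2
  · simp only [Matrix.SpecialLinearGroup.coe_mul, Matrix.mul_apply, Fin.sum_univ_two, h0, h1]
    linear_combination A.1 0 0 * A.1 1 1 * h
  · simp only [Matrix.SpecialLinearGroup.coe_mul, Matrix.mul_apply, Fin.sum_univ_two, h0, h1]
    linear_combination A.1 0 1 * A.1 1 0 * h

theorem fixesAxis_of_mem_center {g : SL(2, ℂ)} (hg : g ∈ Subgroup.center SL(2, ℂ)) :
    FixesAxis g := by
  obtain ⟨r, -, hr⟩ := Matrix.SpecialLinearGroup.mem_center_iff.1 hg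
  constructor <;> rw [← hr] <;> simp

theorem mem_center_of_fixesAxis {g : SL(2, ℂ)} (hg : FixesAxis g) (h : g.1 0 0 = g.1 1 1) :
    g ∈ Subgroup.center SL(2, ℂ) := by
  refine Matrix.SpecialLinearGroup.mem_center_iff.2 ⟨g.1 0 0, ?_, ?_⟩
  · have := hg.det_eq
    rw [← h] at this
    rw [Fintype.card_fin, sq, this]
  · ext i j
    fin_cases i <;> fin_cases j <;> simp [hg.1, hg.2, h]

theorem trace_conj_SL2 (h X : SL(2, ℂ)) : (h⁻¹ * X * h).1.trace = X.1.trace := by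
  rw [mul_assoc, Matrix.SpecialLinearGroup.coe_mul, Matrix.trace_mul_comm,
    ← Matrix.SpecialLinearGroup.coe_mul]
  simp

/-- The distance between an axis of `G` and its image by `A` in terms of traces. -/
theorem axisCosh_eq_trace {h A G : SL(2, ℂ)} (hG : FixesAxis (h⁻¹ * G * h))
    (hne : (G : PSL2C) ≠ 1) :
    axisCosh (h⁻¹ * A * h) = (‖(A * G * A⁻¹ * G⁻¹).1.trace - 2‖ +
        ‖G.1.trace ^ 2 - (A * G * A⁻¹ * G⁻¹).1.trace - 2‖) / ‖G.1.trace ^ 2 - 4‖ := by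
  rw [← trace_conj_SL2 h G, ← trace_conj_SL2 h (A * G * A⁻¹ * G⁻¹),
    show h⁻¹ * (A * G * A⁻¹ * G⁻¹) * h = (h⁻¹ * A * h) * (h⁻¹ * G * h) * (h⁻¹ * A * h)⁻¹ *
      (h⁻¹ * G * h)⁻¹ by group]
  -- Equal diagonal entries would make the diagonal matrix `±1`, and `G` would be trivial in
  -- `PSL2C`.
  have hcen : (h⁻¹ * G * h).1 0 0 - (h⁻¹ * G * h).1 1 1 ≠ 0 := by
    intro h0
    apply hne
    rw [QuotientGroup.eq_one_iff]
    have h1 := mem_center_of_fixesAxis hG (sub_eq_zero.1 h0)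
    have h2 := (inferInstance : (Subgroup.center SL(2, ℂ)).Normal).conj_mem _ h1 h
    rwa [show h * (h⁻¹ * G * h) * h⁻¹ = G by group] at h2
  generalize h⁻¹ * A * h = A' at *
  generalize h⁻¹ * G * h = G' at *
  have hdet := hG.det_eq
  have hA := det_entries A'
  have t1 : (A' * G' * A'⁻¹ * G'⁻¹).1.trace =
      2 * (A'.1 0 0 * A'.1 1 1) - A'.1 0 1 * A'.1 1 0 * (G'.1 0 0 ^ 2 + G'.1 1 1 ^ 2) := by
    simp only [Matrix.SpecialLinearGroup.coe_mul, coe_inv_SL2, Matrix.trace_fin_two,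
      Matrix.mul_apply, Fin.sum_univ_two, hG.1, hG.2, Matrix.of_apply, Matrix.cons_val',
      Matrix.cons_val_zero, Matrix.cons_val_one, Matrix.cons_val_fin_one]
    linear_combination 2 * (A'.1 0 0 * A'.1 1 1) * hdet
  have t2 : G'.1.trace = G'.1 0 0 + G'.1 1 1 := Matrix.trace_fin_two _
  rw [t1, t2]
  set D := (G'.1 0 0 - G'.1 1 1) ^ 2 with hD
  have hD0 : D ≠ 0 := pow_ne_zero 2 hcen
  rw [show 2 * (A'.1 0 0 * A'.1 1 1) - A'.1 0 1 * A'.1 1 0 * (G'.1 0 0 ^ 2 + G'.1 1 1 ^ 2) - 2 =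
      -(A'.1 0 1 * A'.1 1 0 * D) by
      rw [hD]; linear_combination 2 * hA - 2 * (A'.1 0 1 * A'.1 1 0) * hdet,
    show (G'.1 0 0 + G'.1 1 1) ^ 2 -
      (2 * (A'.1 0 0 * A'.1 1 1) - A'.1 0 1 * A'.1 1 0 * (G'.1 0 0 ^ 2 + G'.1 1 1 ^ 2)) - 2 =
      A'.1 0 0 * A'.1 1 1 * D by
      rw [hD]
      linear_combination (2 + 2 * (A'.1 0 0 * A'.1 1 1)) * hdet -
        (G'.1 0 0 ^ 2 + G'.1 1 1 ^ 2) * hA,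
    show (G'.1 0 0 + G'.1 1 1) ^ 2 - 4 = D by rw [hD]; linear_combination 4 * hdet,
    norm_neg, norm_mul _ D, norm_mul _ D, ← add_mul, mul_div_cancel_right₀ _ (norm_ne_zero_iff.2 hD0),
    add_comm]
  rfl

/-- If a matrix acts as a translation along the axis on the diagonal entries, it fixes the axis. -/
theorem fixesAxis_of_translation {g : SL(2, ℂ)} {k e : ℝ} {b : ℂ} (hk : 0 < k)
    (h0 : ∀ z : ℝ, (g.1 * hermMatrix (Real.exp z * k) (Real.exp (-z) * k) b *
      g.1.conjTranspose) 0 0 = ((Real.exp (z + e) * k : ℝ) : ℂ))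
    (h1 : ∀ z : ℝ, (g.1 * hermMatrix (Real.exp z * k) (Real.exp (-z) * k) b *
      g.1.conjTranspose) 1 1 = ((Real.exp (-(z + e)) * k : ℝ) : ℂ)) : FixesAxis g := by
  have hk0 : (k : ℂ) ≠ 0 := by exact_mod_cast hk.ne'
  have hexp : ∀ i, ∀ z : ℝ, (g.1 * hermMatrix (Real.exp z * k) (Real.exp (-z) * k) b *
      g.1.conjTranspose) i i = (Real.exp z : ℂ) * k * (g.1 i 0 * star (g.1 i 0)) +
        (Real.exp (-z) : ℂ) * k * (g.1 i 1 * star (g.1 i 1)) +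
        (g.1 i 1 * star b * star (g.1 i 0) + g.1 i 0 * b * star (g.1 i 1)) := by
    intro i z
    simp only [Matrix.mul_apply, Fin.sum_univ_two, Matrix.conjTranspose_apply, hermMatrix,
      Matrix.of_apply, Matrix.cons_val', Matrix.cons_val_zero, Matrix.cons_val_one,
      Matrix.cons_val_fin_one, Complex.ofReal_mul]
    ring
  -- Each diagonal entry has the form `α eᶻ + β e⁻ᶻ + c`. The values at `eᶻ = 1, 2, 4` suffice to
  -- isolate `β` in the first entry and `α` in the second, and both must vanish.
  have l1 : Real.exp (Real.log 2) = 2 := Real.exp_log (by norm_num)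
  have l2 : Real.exp (Real.log 4) = 4 := Real.exp_log (by norm_num)
  have key : ∀ x : ℂ, k * (x * star x) = 0 → x = 0 := by
    intro x hx
    rcases mul_eq_zero.1 hx with h | h
    · exact absurd h hk0
    · rcases mul_eq_zero.1 h with h | h
      · exact h
      · exact star_eq_zero.1 h
  constructor
  · have e0 := h0 0
    have e1 := h0 (Real.log 2)
    have e2 := h0 (Real.log 4)
    rw [hexp] at e0 e1 e2
    simp only [Real.exp_add, Real.exp_neg, l1, l2, Real.exp_zero] at e0 e1 e2
    apply key
    push_cast at e0 e1 e2
    linear_combination (8 / 3 : ℂ) * e0 - 4 * e1 + (4 / 3 : ℂ) * e2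
  · have e0 := h1 0
    have e1 := h1 (Real.log 2)
    have e2 := h1 (Real.log 4)
    rw [hexp] at e0 e1 e2
    simp only [neg_add, Real.exp_add, Real.exp_neg, l1, l2, Real.exp_zero] at e0 e1 e2
    apply key
    push_cast at e0 e1 e2
    linear_combination (1 / 3 : ℂ) * e0 - e1 + (2 / 3 : ℂ) * e2

theorem normSq_conj_entry (g : Matrix (Fin 2) (Fin 2) ℂ) (i : Fin 2) (p p' : ℝ) :
    (g * hermMatrix p p' 0 * g.conjTranspose) i i =
      ((‖g i 0‖ ^ 2 * p + ‖g i 1‖ ^ 2 * p' : ℝ) : ℂ) := by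
  have h : ∀ x : ℂ, ((‖x‖ ^ 2 : ℝ) : ℂ) = x * star x := by
    intro x; rw [Complex.star_def, Complex.mul_conj, Complex.normSq_eq_norm_sq]
  rw [Complex.ofReal_add, Complex.ofReal_mul, Complex.ofReal_mul, h, h]
  simp only [Matrix.mul_apply, Fin.sum_univ_two, Matrix.conjTranspose_apply, hermMatrix,
    Matrix.of_apply, Matrix.cons_val', Matrix.cons_val_zero, Matrix.cons_val_one,
    Matrix.cons_val_fin_one, star_zero]
  ring

/-- If `P` and `Q` are the ends of a common perpendicular of length `t`, `P` on the axis and `Q` on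
the preimage of the axis by `B`, then `axisCosh B` is the hyperbolic cosine of `t`. -/
theorem axisCosh_eq_cosh {B : SL(2, ℂ)} {P Q : Matrix (Fin 2) (Fin 2) ℂ} {t : ℝ}
    (hP : P.IsHermitian) (hQ : Q.IsHermitian) (hPP : detPolar P P = 2) (hQQ : detPolar Q Q = 2)
    (hPQ : detPolar P Q = ((2 * Real.cosh t : ℝ) : ℂ))
    (hP0 : P 0 1 = 0) (hQ0 : ‖Q 0 1‖ = Real.sinh t)
    (hBQ : (B.1 * Q * B.1.conjTranspose) 0 1 = 0)
    (hBP : ‖(B.1 * P * B.1.conjTranspose) 0 1‖ = Real.sinh t) : axisCosh B = Real.cosh t := by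
  -- `p q'` and `p' q` have sum `2 cosh t` and product `q q' = 1 + sinh² t = cosh² t`, so both equal
  -- `cosh t`. This applies to the pair `P`, `Q` and to its image under `B` with the roles
  -- exchanged.
  have two : ∀ {p p' q q' : ℝ} {b : ℂ}, detPolar (hermMatrix p p' 0) (hermMatrix p p' 0) = 2 →
      detPolar (hermMatrix q q' b) (hermMatrix q q' b) = 2 →
      detPolar (hermMatrix p p' 0) (hermMatrix q q' b) = ((2 * Real.cosh t : ℝ) : ℂ) →
      ‖b‖ = Real.sinh t → p * p' = 1 ∧ p * q' = Real.cosh t ∧ p' * q = Real.cosh t := by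
    intro p p' q q' b h1 h2 h3 h4
    rw [detPolar_hermMatrix] at h1 h2 h3
    have h1' : p * p' + p' * p - 2 * ((0 : ℂ).re * (0 : ℂ).re + (0 : ℂ).im * (0 : ℂ).im) = 2 := by
      exact_mod_cast h1
    have h2' : q * q' + q' * q - 2 * (b.re * b.re + b.im * b.im) = 2 := by exact_mod_cast h2
    have h3' := Complex.ofReal_injective h3
    simp only [Complex.zero_re, Complex.zero_im] at h1' h3'
    have hb : b.re * b.re + b.im * b.im = Real.sinh t ^ 2 := by
      rw [← h4, ← Complex.normSq_eq_norm_sq, Complex.normSq_apply]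
    have hc := Real.cosh_sq t
    have e1 : p * p' = 1 := by linarith
    have e2 : q * q' = Real.cosh t ^ 2 := by linarith
    have e3 : p * q' + p' * q = 2 * Real.cosh t := by linarith
    have e4 : (p * q' - p' * q) ^ 2 = 0 := by
      linear_combination (p * q' + p' * q + 2 * Real.cosh t) * e3 - 4 * (q * q') * e1 - 4 * e2
    have e5 := pow_eq_zero_iff two_ne_zero |>.1 e4
    exact ⟨e1, by linarith, by linarith⟩
  have herm : ∀ A : Matrix (Fin 2) (Fin 2) ℂ, A.IsHermitian →
      (B.1 * A * B.1.conjTranspose).IsHermitian := fun A hA =>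
    Matrix.isHermitian_mul_mul_conjTranspose _ hA
  have hinv : ∀ A : Matrix (Fin 2) (Fin 2) ℂ,
      B⁻¹.1 * (B.1 * A * B.1.conjTranspose) * B⁻¹.1.conjTranspose = A := by
    intro A
    have h1 : B⁻¹.1 * B.1 = 1 := congrArg Subtype.val (inv_mul_cancel B)
    have h2 : B.1.conjTranspose * B⁻¹.1.conjTranspose = 1 := by
      rw [← Matrix.conjTranspose_mul, h1, Matrix.conjTranspose_one]
    calc _ = (B⁻¹.1 * B.1) * A * (B.1.conjTranspose * B⁻¹.1.conjTranspose) := by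
          simp only [Matrix.mul_assoc]
      _ = A := by rw [h1, h2, Matrix.one_mul, Matrix.mul_one]
  have hPe := exists_hermMatrix hP
  have hQe := exists_hermMatrix hQ
  have hNe := exists_hermMatrix (herm P hP)
  have hMe := exists_hermMatrix (herm Q hQ)
  rw [hP0] at hPe
  rw [hBQ] at hMe
  have hNN := (detPolar_smul_smul B.1 P P B.2).trans hPP
  have hMM := (detPolar_smul_smul B.1 Q Q B.2).trans hQQ
  have hMN := (detPolar_smul_smul B.1 Q P B.2).trans ((detPolar_comm Q P).trans hPQ)
  have n0 := normSq_conj_entry B.1 0 (P 0 0).re (P 1 1).re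
  have n1 := normSq_conj_entry B.1 1 (P 0 0).re (P 1 1).re
  rw [← hPe] at n0 n1
  have q0 := normSq_conj_entry B⁻¹.1 0 ((B.1 * Q * B.1.conjTranspose) 0 0).re
    ((B.1 * Q * B.1.conjTranspose) 1 1).re
  have q1 := normSq_conj_entry B⁻¹.1 1 ((B.1 * Q * B.1.conjTranspose) 0 0).re
    ((B.1 * Q * B.1.conjTranspose) 1 1).re
  rw [← hMe, hinv] at q0 q1
  replace n0 := congrArg Complex.re n0
  replace n1 := congrArg Complex.re n1
  replace q0 := congrArg Complex.re q0
  replace q1 := congrArg Complex.re q1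
  rw [Complex.ofReal_re] at n0 n1 q0 q1
  rw [coe_inv_SL2] at q0 q1
  simp only [Matrix.of_apply, Matrix.cons_val', Matrix.cons_val_zero, Matrix.cons_val_one,
    Matrix.cons_val_fin_one, norm_neg] at q0 q1
  rw [hPe] at hPP hPQ
  rw [hQe] at hQQ hPQ
  rw [hMe] at hMM hMN
  rw [hNe] at hNN hMN
  obtain ⟨a1, a2, a3⟩ := two hPP hQQ hPQ hQ0
  obtain ⟨b1, b2, b3⟩ := two hMM hNN hMN hBP
  rw [n1] at b2
  rw [n0] at b3
  rw [q1] at a2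
  rw [q0] at a3
  generalize (P 0 0).re = p at *
  generalize (P 1 1).re = p' at *
  generalize ((B.1 * Q * B.1.conjTranspose) 0 0).re = m at *
  generalize ((B.1 * Q * B.1.conjTranspose) 1 1).re = m' at *
  unfold axisCosh
  rw [norm_mul, norm_mul]
  have na := norm_nonneg (B.1 0 0)
  have nb := norm_nonneg (B.1 0 1)
  have nc := norm_nonneg (B.1 1 0)
  have nd := norm_nonneg (B.1 1 1)
  generalize ‖B.1 0 0‖ = a at *
  generalize ‖B.1 0 1‖ = b at *
  generalize ‖B.1 1 0‖ = c at *
  generalize ‖B.1 1 1‖ = d at *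
  have hC := Real.cosh_pos t
  generalize Real.cosh t = C at *
  -- Four relations between `a² p m'`, `b² p' m'`, `c² p m` and `d² p' m` make the outer two equal
  -- and the inner two equal. As `p p' = m m' = 1`, these common values are `±ad` and `±bc` in
  -- moduli; they have the same sign and sum `C`.
  have had : a ^ 2 * (p * m') = d ^ 2 * (p' * m) := by linarith
  have hbc : b ^ 2 * (p' * m') = c ^ 2 * (p * m) := by linarith
  have e1 : a * d = |a ^ 2 * (p * m')| := by
    rw [← abs_of_nonneg (mul_nonneg na nd), ← sq_eq_sq_iff_abs_eq_abs]
    linear_combination -(a ^ 2 * d ^ 2) * (p * p') * b1 - a ^ 2 * d ^ 2 * a1 -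
      a ^ 2 * (p * m') * had
  have e2 : b * c = |b ^ 2 * (p' * m')| := by
    rw [← abs_of_nonneg (mul_nonneg nb nc), ← sq_eq_sq_iff_abs_eq_abs]
    linear_combination -(b ^ 2 * c ^ 2) * (p * p') * b1 - b ^ 2 * c ^ 2 * a1 -
      b ^ 2 * (p' * m') * hbc
  have e3 : 0 ≤ (a ^ 2 * (p * m')) * (b ^ 2 * (p' * m')) := by
    have : (a ^ 2 * (p * m')) * (b ^ 2 * (p' * m')) = (a * b * m') ^ 2 := by
      linear_combination (a * b * m') ^ 2 * a1
    rw [this]; positivity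
  have e4 : a ^ 2 * (p * m') + b ^ 2 * (p' * m') = C := by linarith
  rw [e1, e2, ← (abs_add_eq_add_abs_iff _ _).2 (by
    rcases mul_nonneg_iff.1 e3 with h | h
    · exact Or.inl h
    · exact Or.inr h), e4, abs_of_pos hC]

/-! ### The metric of the hyperbolic cone in coordinates -/

/-- A parametrization of the hyperbolic cone without its edge. -/
def toCyl (a : ℝ × ℝ × ℝ) : Cyl := (a.1.toNNReal, a.2)

/-- The expression whose inverse hyperbolic cosine is the distance in the cone. -/
def coneCosh (θ : ℝ) (a b : Cyl) : ℝ :=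
  Real.cosh a.1 * Real.cosh b.1 * Real.cosh (a.2.2 - b.2.2) -
    Real.sinh a.1 * Real.sinh b.1 * Real.cos ‖((a.2.1 - b.2.1 : ℝ) : AddCircle θ)‖

/-- The radial, axial and angular contributions are separated; the last two are nonnegative and the
first is at least 1, so a bound on the sum controls each coordinate. -/
theorem coneCosh_eq (θ : ℝ) (a b : Cyl) : coneCosh θ a b = Real.cosh (a.1 - b.1) +
    Real.cosh a.1 * Real.cosh b.1 * (Real.cosh (a.2.2 - b.2.2) - 1) +
    Real.sinh a.1 * Real.sinh b.1 * (1 - Real.cos ‖((a.2.1 - b.2.1 : ℝ) : AddCircle θ)‖) := by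
  rw [coneCosh, Real.cosh_sub (a.1 : ℝ)]; ring

theorem coneCosh_terms_nonneg (θ : ℝ) (a b : Cyl) :
    0 ≤ Real.cosh a.1 * Real.cosh b.1 * (Real.cosh (a.2.2 - b.2.2) - 1) ∧
    0 ≤ Real.sinh a.1 * Real.sinh b.1 *
      (1 - Real.cos ‖((a.2.1 - b.2.1 : ℝ) : AddCircle θ)‖) := by
  have h1 := Real.one_le_cosh (a.2.2 - b.2.2)
  have h2 := Real.cos_le_one ‖((a.2.1 - b.2.1 : ℝ) : AddCircle θ)‖
  have h3 := Real.sinh_nonneg_iff.2 a.1.2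
  have h4 := Real.sinh_nonneg_iff.2 b.1.2
  have h5 := Real.cosh_pos a.1
  have h6 := Real.cosh_pos b.1
  exact ⟨mul_nonneg (mul_pos h5 h6).le (by linarith), mul_nonneg (mul_nonneg h3 h4) (by linarith)⟩

theorem one_le_coneCosh (θ : ℝ) (a b : Cyl) : 1 ≤ coneCosh θ a b := by
  obtain ⟨h1, h2⟩ := coneCosh_terms_nonneg θ a b
  rw [coneCosh_eq]
  linarith [Real.one_le_cosh ((a.1 : ℝ) - b.1)]

theorem coneDist_lt_iff {θ : ℝ} {a b : Cyl} {δ : ℝ} (hδ : 0 < δ) :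
    coneDist θ a b < δ ↔ coneCosh θ a b < Real.cosh δ := by
  have h := one_le_coneCosh θ a b
  conv_lhs => rw [← Real.arcosh_cosh hδ.le]
  exact Real.arcosh_lt_arcosh (zero_lt_one.trans_le h) (Real.cosh_pos δ)

theorem coneDist_self (θ : ℝ) (a : Cyl) : coneDist θ a a = 0 := by
  have : coneCosh θ a a = 1 := by rw [coneCosh_eq]; simp
  change Real.arcosh (coneCosh θ a a) = 0
  rw [this, Real.arcosh_zero]

theorem radius_lt_of_coneDist_lt {θ : ℝ} {a b : Cyl} (ha : a.1 = 0) {δ : ℝ}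
    (h : coneDist θ a b < δ) : (b.1 : ℝ) < δ := by
  have hδ : 0 < δ := (Real.arcosh_nonneg (one_le_coneCosh θ a b)).trans_lt h
  rw [coneDist_lt_iff hδ, coneCosh_eq] at h
  obtain ⟨h1, h2⟩ := coneCosh_terms_nonneg θ a b
  have h3 : Real.cosh ((a.1 : ℝ) - b.1) < Real.cosh δ := by linarith
  rw [Real.cosh_lt_cosh, ha] at h3
  simpa [abs_of_pos hδ] using h3

theorem toCyl_fst {a : ℝ × ℝ × ℝ} (ha : 0 < a.1) : ((toCyl a).1 : ℝ) = a.1 :=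
  Real.coe_toNNReal _ ha.le

theorem continuous_coneDist (θ : ℝ) (a : ℝ × ℝ × ℝ) :
    Continuous fun b => coneDist θ (toCyl a) (toCyl b) := by
  have h1 : Continuous fun b : ℝ × ℝ × ℝ => ((a.2.1 - b.2.1 : ℝ) : AddCircle θ) :=
    (AddCircle.continuous_mk' θ).comp (by fun_prop)
  refine Real.continuousOn_arcosh.comp_continuous ?_ fun b => one_le_coneCosh θ (toCyl a) (toCyl b)
  have h2 : Continuous fun b : ℝ × ℝ × ℝ => ((toCyl b).1 : ℝ) :=
    NNReal.continuous_coe.comp (continuous_real_toNNReal.comp continuous_fst)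
  have h3 := Real.continuous_cosh.comp h2
  have h4 := Real.continuous_sinh.comp h2
  have h5 := Real.continuous_cos.comp h1.norm
  have h6 : Continuous fun b : ℝ × ℝ × ℝ => Real.cosh ((toCyl a).2.2 - (toCyl b).2.2) :=
    Real.continuous_cosh.comp (by unfold toCyl; fun_prop)
  exact ((continuous_const.mul h3).mul h6).sub ((continuous_const.mul h4).mul h5)

/-- Up to half a period the norm in `AddCircle θ` is the absolute value of the difference of angles,
so there the cone metric is the hyperbolic one. -/
theorem coneDist_toCyl {θ : ℝ} {a b : ℝ × ℝ × ℝ} (ha : 0 < a.1) (hb : 0 < b.1)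
    (h : |a.2.1 - b.2.1| ≤ |θ| / 2) : coneDist θ (toCyl a) (toCyl b) =
      Real.arcosh ((detPolar (cylMatrix a) (cylMatrix b)).re / 2) := by
  rw [detPolar_cylMatrix, Complex.ofReal_re, mul_div_cancel_left₀ _ two_ne_zero, coneDist,
    toCyl_fst ha, toCyl_fst hb]
  rcases eq_or_ne θ 0 with rfl | hθ
  · simp only [abs_zero, zero_div, abs_nonpos_iff] at h
    simp [toCyl, h]
  · rw [show ((toCyl a).2.1 - (toCyl b).2.1) = a.2.1 - b.2.1 from rfl,
      (AddCircle.norm_coe_eq_abs_iff θ hθ).2 h, Real.cos_abs]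
    rfl

/-- A small cone distance forces nearby coordinates, the angle up to a multiple of `θ`. As `θ < 2π`,
the angle between half-planes is at most `π`, where the cosine determines it. -/
theorem exists_near_of_coneDist_lt {θ : ℝ} (hθ : 0 < θ) (hθ' : θ < 2 * Real.pi) {a : ℝ × ℝ × ℝ}
    (ha : 0 < a.1) {O : Set (ℝ × ℝ × ℝ)} (hO : O ∈ 𝓝 a) :
    ∃ δ > 0, ∀ b : Cyl, coneDist θ (toCyl a) b < δ →
      ∃ m : ℤ, ((b.1 : ℝ), b.2.1 + m * θ, b.2.2) ∈ O ∧ 0 < (b.1 : ℝ) := by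
  obtain ⟨κ₀, hκ₀, hball⟩ := Metric.mem_nhds_iff.1 hO
  obtain ⟨κ, hκ, k1, k2, k3⟩ : ∃ κ : ℝ, 0 < κ ∧ κ ≤ κ₀ ∧ κ ≤ a.1 / 2 ∧ κ ≤ Real.pi :=
    ⟨min κ₀ (min (a.1 / 2) Real.pi), lt_min hκ₀ (lt_min (by linarith) Real.pi_pos),
      min_le_left _ _, (min_le_right _ _).trans (min_le_left _ _),
      (min_le_right _ _).trans (min_le_right _ _)⟩
  have hcκ : 0 < 1 - Real.cos κ := by
    have := Real.strictAntiOn_cos ⟨le_rfl, Real.pi_pos.le⟩ ⟨hκ.le, k3⟩ hκ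
    rw [Real.cos_zero] at this; linarith
  have hs1 : 0 < Real.sinh a.1 := Real.sinh_pos_iff.2 ha
  have hs2 : 0 < Real.sinh (a.1 / 2) := Real.sinh_pos_iff.2 (by linarith)
  have hch : 0 < Real.cosh κ - 1 := sub_pos.2 (Real.one_lt_cosh.2 hκ.ne')
  -- The first bound on `η` controls the radius and the height. The second controls the angle, using
  -- that the radius of `b` exceeds half that of `a`.
  obtain ⟨η, hη, e1, e2⟩ : ∃ η : ℝ, 0 < η ∧ η ≤ Real.cosh κ - 1 ∧
      η ≤ Real.sinh a.1 * Real.sinh (a.1 / 2) * (1 - Real.cos κ) :=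
    ⟨min _ _, lt_min hch (by positivity), min_le_left _ _, min_le_right _ _⟩
  refine ⟨Real.arcosh (1 + η), Real.arcosh_pos (by linarith), fun b hb => ?_⟩
  rw [coneDist_lt_iff (Real.arcosh_pos (by linarith)), Real.cosh_arcosh (by linarith), coneCosh_eq,
    toCyl_fst ha] at hb
  obtain ⟨t1, t2⟩ := coneCosh_terms_nonneg θ (toCyl a) b
  rw [toCyl_fst ha] at t1 t2
  have c0 := Real.one_le_cosh (a.1 - b.1)
  have r1 : |a.1 - b.1| < κ := by
    have : Real.cosh (a.1 - b.1) < Real.cosh κ := by linarith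
    rwa [Real.cosh_lt_cosh, abs_of_pos hκ] at this
  have rb : a.1 / 2 < b.1 := by linarith [(abs_lt.1 r1).2]
  have z1 : |a.2.2 - b.2.2| < κ := by
    have h1 : 1 ≤ Real.cosh a.1 * Real.cosh b.1 :=
      one_le_mul_of_one_le_of_one_le (Real.one_le_cosh _) (Real.one_le_cosh _)
    have h2 := Real.one_le_cosh ((toCyl a).2.2 - b.2.2)
    have h3 : Real.cosh ((toCyl a).2.2 - b.2.2) < Real.cosh κ := by nlinarith
    rwa [Real.cosh_lt_cosh, abs_of_pos hκ] at h3
  set n := ‖(((toCyl a).2.1 - b.2.1 : ℝ) : AddCircle θ)‖ with hn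
  have n0 : 0 ≤ n := norm_nonneg _
  have nπ : n ≤ Real.pi := by
    have := AddCircle.norm_le_half_period θ hθ.ne' (x := (((toCyl a).2.1 - b.2.1 : ℝ) : AddCircle θ))
    rw [abs_of_pos hθ] at this
    linarith
  have n1 : n < κ := by
    have h1 : Real.sinh (a.1 / 2) ≤ Real.sinh b.1 := Real.sinh_le_sinh.2 rb.le
    have h2 : Real.sinh a.1 * Real.sinh (a.1 / 2) * (1 - Real.cos n) <
        Real.sinh a.1 * Real.sinh (a.1 / 2) * (1 - Real.cos κ) := by
      have : Real.sinh a.1 * Real.sinh (a.1 / 2) * (1 - Real.cos n) ≤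
          Real.sinh a.1 * Real.sinh b.1 * (1 - Real.cos n) := by
        have := Real.cos_le_one n
        gcongr
      linarith
    have h3 := lt_of_mul_lt_mul_left h2 (by positivity)
    by_contra hcon
    have := Real.strictAntiOn_cos.antitoneOn ⟨hκ.le, k3⟩ ⟨n0, nπ⟩ (not_lt.1 hcon)
    linarith
  refine ⟨round (θ⁻¹ * (a.2.1 - b.2.1)), hball ?_, by linarith⟩
  rw [AddCircle.norm_eq] at hn
  have n2 : |a.2.1 - b.2.1 - round (θ⁻¹ * (a.2.1 - b.2.1)) * θ| < κ := by
    have : n = |a.2.1 - b.2.1 - round (θ⁻¹ * (a.2.1 - b.2.1)) * θ| := hn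
    rwa [← this]
  rw [Metric.mem_ball, dist_comm, Prod.dist_eq, Prod.dist_eq, Real.dist_eq, Real.dist_eq,
    Real.dist_eq]
  refine max_lt (r1.trans_le k1) (max_lt ?_ (z1.trans_le k1))
  rw [← sub_sub]
  exact n2.trans_le k1

/-! ### The chart of a tube -/

/-- The data of a tube: `f` induces a local isometry from the solid torus onto `U`. -/
structure IsTubeChart {N : Type*} [MetricSpace N] (θ R ℓ τ : ℝ) (f : Cyl → N) (U : Set N) :
    Prop where
  angle_pos : 0 < θ
  angle_lt : θ < 2 * Real.pi
  radius_pos : 0 < R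
  isometric : ∀ a : Cyl, (a.1 : ℝ) < R → ∃ ε > 0, IsIsometricOnConeBall θ f a ε
  eq_iff : ∀ a b : Cyl, (a.1 : ℝ) < R → (b.1 : ℝ) < R →
    (f a = f b ↔ a.1 = b.1 ∧ ∃ n : ℤ, b.2.2 = a.2.2 + n * ℓ ∧
      (a.1 = 0 ∨ ∃ m : ℤ, b.2.1 = a.2.1 + n * τ + m * θ))
  core : f '' {a | a.1 = 0} = singularLocus N
  image : f '' {a | (a.1 : ℝ) < R} = U

/-- The deck transformations of the universal covering of a tube without its core. -/
def tubeShift (R θ ℓ τ : ℝ) (n m : ℤ) (a : tubeCover R) : tubeCover R :=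
  ⟨(a.1.1, a.1.2.1 + (n * τ + m * θ), a.1.2.2 + n * ℓ), a.2⟩

theorem continuous_tubeShift (R θ ℓ τ : ℝ) (n m : ℤ) : Continuous (tubeShift R θ ℓ τ n m) := by
  unfold tubeShift
  fun_prop

theorem surjective_tubeShift (R θ ℓ τ : ℝ) (n m : ℤ) :
    Function.Surjective (tubeShift R θ ℓ τ n m) := by
  rintro ⟨a, ha⟩
  refine ⟨⟨(a.1, a.2.1 - (n * τ + m * θ), a.2.2 - n * ℓ), ha⟩, ?_⟩
  simp [tubeShift]

namespace IsTubeChart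

variable {N : Type*} [MetricSpace N] {θ R ℓ τ : ℝ} {f : Cyl → N} {U : Set N}

theorem toCyl_lt {a : ℝ × ℝ × ℝ} (ha : a ∈ tubeCover R) : ((toCyl a).1 : ℝ) < R := by
  rw [toCyl_fst ha.1]; exact ha.2

theorem toCyl_ne_zero {a : ℝ × ℝ × ℝ} (ha : a ∈ tubeCover R) : (toCyl a).1 ≠ 0 := by
  rw [← NNReal.coe_ne_zero, toCyl_fst ha.1]; exact ha.1.ne'

theorem notMem_singularLocus (hf : IsTubeChart θ R ℓ τ f U) (a : tubeCover R) :
    f (toCyl a) ∉ singularLocus N := by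
  rw [← hf.core]
  rintro ⟨b, hb, hab⟩
  have hbR : (b.1 : ℝ) < R := by rw [show b.1 = 0 from hb]; exact hf.radius_pos
  have := ((hf.eq_iff b (toCyl a) hbR (toCyl_lt a.2)).1 hab).1
  exact toCyl_ne_zero a.2 (this.symm.trans hb)

/-- The covering map from cylindrical coordinates to the tube without its core. -/
def coverMap (hf : IsTubeChart θ R ℓ τ f U) (a : tubeCover R) : regularPart N :=
  ⟨f (toCyl a), hf.notMem_singularLocus a⟩

theorem exists_coverMap_eq (hf : IsTubeChart θ R ℓ τ f U) {x : regularPart N} (hx : (x : N) ∈ U) :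
    ∃ a, hf.coverMap a = x := by
  rw [← hf.image] at hx
  obtain ⟨b, hb, hbx⟩ := hx
  have hb0 : b.1 ≠ 0 := fun h => x.2 (hf.core.subset ⟨b, h, hbx⟩)
  have hb0' : (0 : ℝ) < b.1 := NNReal.coe_pos.2 (pos_iff_ne_zero.2 hb0)
  refine ⟨⟨((b.1 : ℝ), b.2), hb0', hb⟩, Subtype.ext ?_⟩
  rw [← hbx]
  simp [coverMap, toCyl]

theorem coverMap_mem (hf : IsTubeChart θ R ℓ τ f U) (a : tubeCover R) :
    (hf.coverMap a : N) ∈ U :=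
  hf.image.subset ⟨_, toCyl_lt a.2, rfl⟩

theorem coverMap_tubeShift (hf : IsTubeChart θ R ℓ τ f U) (n m : ℤ) (a : tubeCover R) :
    hf.coverMap (tubeShift R θ ℓ τ n m a) = hf.coverMap a :=
  Subtype.ext ((hf.eq_iff _ _ (toCyl_lt a.2) (toCyl_lt (tubeShift R θ ℓ τ n m a).2)).2
    ⟨rfl, n, rfl, Or.inr ⟨m, (add_assoc _ _ _).symm⟩⟩).symm

theorem exists_tubeShift (hf : IsTubeChart θ R ℓ τ f U) {a b : tubeCover R}
    (h : hf.coverMap a = hf.coverMap b) : ∃ n m : ℤ, b = tubeShift R θ ℓ τ n m a := by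
  obtain ⟨h1, n, h2, h3⟩ := (hf.eq_iff _ _ (toCyl_lt a.2) (toCyl_lt b.2)).1 (congrArg Subtype.val h)
  obtain ⟨m, h3⟩ := h3.resolve_left (toCyl_ne_zero a.2)
  have h1' := congrArg NNReal.toReal h1
  rw [toCyl_fst a.2.1, toCyl_fst b.2.1] at h1'
  refine ⟨n, m, Subtype.ext (Prod.ext h1'.symm (Prod.ext ?_ h2))⟩
  exact h3.trans (add_assoc _ _ _)

theorem exists_isometric_nhds (hf : IsTubeChart θ R ℓ τ f U) (y : tubeCover R) :
    ∃ W ∈ 𝓝 y, ∀ b ∈ W, ∀ c ∈ W, dist (hf.coverMap b) (hf.coverMap c) =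
      Real.arcosh ((detPolar (cylMatrix b) (cylMatrix c)).re / 2) := by
  obtain ⟨ε, hε, hiso, -⟩ := hf.isometric (toCyl y) (toCyl_lt y.2)
  have hθ := hf.angle_pos
  -- Two angles within `θ / 4` of that of `y` differ by less than `θ / 2`, the range of
  -- `coneDist_toCyl`.
  refine ⟨{b | coneDist θ (toCyl y) (toCyl b) < ε ∧ |b.1.2.1 - y.1.2.1| < θ / 4}, ?_, ?_⟩
  · have h1 : Continuous fun b : tubeCover R => coneDist θ (toCyl y) (toCyl b) :=
      (continuous_coneDist θ y).comp continuous_subtype_val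
    have h2 : Continuous fun b : tubeCover R => |b.1.2.1 - y.1.2.1| := by fun_prop
    refine ((isOpen_lt h1 continuous_const).inter (isOpen_lt h2 continuous_const)).mem_nhds ?_
    constructor
    · simpa [coneDist_self] using hε
    · simpa using hθ
  · rintro b ⟨hb1, hb2⟩ c ⟨hc1, hc2⟩
    rw [← coneDist_toCyl (θ := θ) b.2.1 c.2.1]
    · exact hiso _ hb1 _ hc1
    · rw [abs_of_pos hθ]
      rw [abs_lt] at hb2 hc2
      rw [abs_le]
      constructor <;> linarith

theorem continuous_coverMap (hf : IsTubeChart θ R ℓ τ f U) : Continuous hf.coverMap := by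
  rw [continuous_iff_continuousAt]
  intro y
  obtain ⟨ε, hε, hiso, -⟩ := hf.isometric (toCyl y) (toCyl_lt y.2)
  have h1 : Continuous fun b : tubeCover R => coneDist θ (toCyl y) (toCyl b) :=
    (continuous_coneDist θ y).comp continuous_subtype_val
  have h2 := h1.tendsto y
  simp only [coneDist_self] at h2
  rw [ContinuousAt, tendsto_iff_dist_tendsto_zero]
  refine h2.congr' ?_
  filter_upwards [h2.eventually (gt_mem_nhds hε)] with b hb
  have h0 : toCyl y.1 ∈ coneBall θ (toCyl y) ε := by
    change coneDist θ _ _ < ε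
    rw [coneDist_self]; exact hε
  rw [dist_comm]
  exact (hiso _ h0 _ hb).symm

/-- Points of `N` near the image of `y` lie in an isometric cone ball, so they have coordinates near
`y` after an angular shift by a multiple of `θ`, which does not change their image. -/
theorem isOpenMap_coverMap (hf : IsTubeChart θ R ℓ τ f U) : IsOpenMap hf.coverMap := by
  rw [isOpenMap_iff_nhds_le]
  intro y S hS
  rw [mem_map] at hS
  have hO : Subtype.val '' (hf.coverMap ⁻¹' S) ∈ 𝓝 y.1 :=
    (isOpen_tubeCover R).isOpenMap_subtype_val.image_mem_nhds hS
  obtain ⟨ε, hε, hiso, hopen⟩ := hf.isometric (toCyl y) (toCyl_lt y.2)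
  obtain ⟨δ, hδ, H⟩ := exists_near_of_coneDist_lt hf.angle_pos hf.angle_lt y.2.1 hO
  have h0 : toCyl y.1 ∈ coneBall θ (toCyl y) ε := by
    change coneDist θ _ _ < ε
    rw [coneDist_self]; exact hε
  have hnhds : f '' coneBall θ (toCyl y) ε ∩ Metric.ball (f (toCyl y)) δ ∈ 𝓝 (f (toCyl y)) :=
    inter_mem (hopen.mem_nhds ⟨_, h0, rfl⟩) (Metric.ball_mem_nhds _ hδ)
  refine mem_of_superset (continuous_subtype_val.continuousAt.preimage_mem_nhds hnhds) ?_
  rintro x ⟨⟨b, hb, hbx⟩, hx⟩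
  rw [Metric.mem_ball, dist_comm, ← hbx, hiso _ h0 _ hb] at hx
  obtain ⟨m, ⟨b', hb', hbb'⟩, hb0⟩ := H b hx
  have : hf.coverMap b' = x := by
    apply Subtype.ext
    rw [← hbx]
    have hb1 : (toCyl b'.1).1 = b.1 := by
      rw [← NNReal.coe_inj, toCyl_fst b'.2.1, hbb']
    refine ((hf.eq_iff b _ ?_ (toCyl_lt b'.2)).2 ⟨hb1.symm, 0, ?_, Or.inr ⟨m, ?_⟩⟩).symm
    · rw [← hb1]; exact toCyl_lt b'.2
    · simp [toCyl, hbb']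
    · simp [toCyl, hbb']
  rw [← this]
  exact hb'

/-- The images of thin tubes contain neighbourhoods of the singular locus, and its compactness makes
`δ` uniform. This converts convergence to the core in `N` into convergence of the radial coordinate
to 0. -/
theorem radius_lt_of_infDist_lt (hf : IsTubeChart θ R ℓ τ f U)
    (hknot : Nonempty (singularLocus N ≃ₜ Circle)) {ε : ℝ} (hε : 0 < ε) :
    ∃ δ > 0, ∀ a : tubeCover R,
      Metric.infDist (hf.coverMap a : N) (singularLocus N) < δ → a.1.1 < ε := by
  obtain ⟨e⟩ := hknot
  have hcomp : IsCompact (singularLocus N) := by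
    have : CompactSpace (singularLocus N) := e.symm.compactSpace
    exact isCompact_iff_compactSpace.2 this
  have hne : (singularLocus N).Nonempty := ⟨_, (e.symm 1).2⟩
  let V : Set N := {x | ∃ b : Cyl, (b.1 : ℝ) < min ε R ∧ f b = x}
  have hV : singularLocus N ⊆ interior V := by
    intro x hx
    rw [← hf.core] at hx
    obtain ⟨a, ha, rfl⟩ := hx
    have haR : (a.1 : ℝ) < R := by rw [show a.1 = 0 from ha]; exact hf.radius_pos
    obtain ⟨ε', hε', hiso, hopen⟩ := hf.isometric a haR
    have h0 : a ∈ coneBall θ a ε' := by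
      change coneDist θ _ _ < ε'
      rw [coneDist_self]; exact hε'
    rw [mem_interior_iff_mem_nhds]
    refine mem_of_superset (inter_mem (hopen.mem_nhds ⟨_, h0, rfl⟩)
      (Metric.ball_mem_nhds _ (lt_min hε hf.radius_pos))) ?_
    rintro x ⟨⟨b, hb, hbx⟩, hx⟩
    rw [Metric.mem_ball, dist_comm, ← hbx, hiso _ h0 _ hb] at hx
    exact ⟨b, radius_lt_of_coneDist_lt ha hx, hbx⟩
  obtain ⟨δ, hδ, hth⟩ := hcomp.exists_thickening_subset_open isOpen_interior hV
  refine ⟨δ, hδ, fun a ha => ?_⟩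
  obtain ⟨b, hb, hba⟩ := interior_subset
    (hth ((Metric.mem_thickening_iff_infDist_lt hne).2 ha))
  have := ((hf.eq_iff b _ (hb.trans_le (min_le_right _ _)) (toCyl_lt a.2)).1 hba).1
  rw [← toCyl_fst a.2.1, ← this]
  exact hb.trans_le (min_le_left _ _)

end IsTubeChart

/-! ### Lifts of the tube to the universal covering -/

theorem t2Space_of_isCoveringMap {X Y : Type*} [TopologicalSpace X] [TopologicalSpace Y] [T2Space Y]
    {p : X → Y} (hp : IsCoveringMap p) : T2Space X := by
  refine ⟨fun x y hxy => ?_⟩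
  by_cases h : p x = p y
  · exact hp.isSeparatedMap x y h hxy
  · obtain ⟨u, v, hu, hv, hxu, hyv, huv⟩ := t2_separation h
    exact ⟨p ⁻¹' u, p ⁻¹' v, hu.preimage hp.continuous, hv.preimage hp.continuous, hxu, hyv,
      huv.preimage p⟩

theorem H3.dist_self (A : H3) : A.dist A = 0 := by
  rw [H3.dist_eq, detPolar_self, A.2.2]
  simp

namespace IsTubeChart

variable {N : Type*} [MetricSpace N] {θ R ℓ τ : ℝ} {f : Cyl → N} {U : Set N}
  {X : Type*} [TopologicalSpace X] {p : X → regularPart N}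

/-- `F` is a lift of the tube without its core to the covering space `X`. -/
structure IsLift (hf : IsTubeChart θ R ℓ τ f U) (p : X → regularPart N) (F : tubeCover R → X) :
    Prop where
  continuous : Continuous F
  comp : ∀ a, p (F a) = hf.coverMap a

theorem simplyConnectedSpace (hf : IsTubeChart θ R ℓ τ f U) :
    SimplyConnectedSpace (tubeCover R) := by
  have : ContractibleSpace (tubeCover R) := (convex_tubeCover R).contractibleSpace
    ⟨(R / 2, 0, 0), by simp [tubeCover, hf.radius_pos]⟩
  exact SimplyConnectedSpace.ofContractible _

theorem exists_isLift (hf : IsTubeChart θ R ℓ τ f U) (hp : IsCoveringMap p) {x : X}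
    (hx : (p x : N) ∈ U) : ∃ F, hf.IsLift p F ∧ ∃ a, F a = x := by
  obtain ⟨a, ha⟩ := hf.exists_coverMap_eq hx
  have := hf.simplyConnectedSpace
  have : LocallyPathConnectedSpace (tubeCover R) := (isOpen_tubeCover R).locallyPathConnectedSpace
  obtain ⟨F, ⟨hF1, hF2⟩, -⟩ := hp.existsUnique_continuousMap_lifts
    ⟨hf.coverMap, hf.continuous_coverMap⟩ a x ha.symm
  exact ⟨F, ⟨F.continuous, fun b => congrFun hF2 b⟩, a, hF1⟩

theorem IsLift.eq_of_eq {hf : IsTubeChart θ R ℓ τ f U} (hp : IsCoveringMap p)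
    {F F' : tubeCover R → X} (hF : hf.IsLift p F) (hF' : hf.IsLift p F') {a : tubeCover R}
    (h : F a = F' a) : F = F' := by
  have := hf.simplyConnectedSpace
  refine hp.eq_of_comp_eq hF.continuous hF'.continuous ?_ a h
  funext b
  exact (hF.comp b).trans (hF'.comp b).symm

theorem IsLift.tubeShift {hf : IsTubeChart θ R ℓ τ f U} {F : tubeCover R → X}
    (hF : hf.IsLift p F) (n m : ℤ) : hf.IsLift p (F ∘ tubeShift R θ ℓ τ n m) where
  continuous := hF.continuous.comp (continuous_tubeShift R θ ℓ τ n m)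
  comp a := (hF.comp _).trans (hf.coverMap_tubeShift n m a)

theorem IsLift.deck {hf : IsTubeChart θ R ℓ τ f U} {F : tubeCover R → X}
    (hF : hf.IsLift p F) (γ : deckGroup p) : hf.IsLift p (γ.1 ∘ F) where
  continuous := γ.1.continuous.comp hF.continuous
  comp a := (γ.2 _).trans (hF.comp a)

/-- Lifts of a tube with a common point differ by a shift. -/
theorem IsLift.exists_eq_comp_tubeShift {hf : IsTubeChart θ R ℓ τ f U} (hp : IsCoveringMap p)
    {F F' : tubeCover R → X} (hF : hf.IsLift p F) (hF' : hf.IsLift p F') {a b : tubeCover R}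
    (h : F' a = F b) : ∃ n m : ℤ, F' = F ∘ HypCone.tubeShift R θ ℓ τ n m := by
  have h1 : hf.coverMap a = hf.coverMap b := by rw [← hF'.comp, ← hF.comp, h]
  obtain ⟨n, m, rfl⟩ := hf.exists_tubeShift h1
  exact ⟨n, m, hF'.eq_of_eq hp (hF.tubeShift n m) h⟩

theorem IsLift.range_eq_of_eq {hf : IsTubeChart θ R ℓ τ f U} (hp : IsCoveringMap p)
    {F F' : tubeCover R → X} (hF : hf.IsLift p F) (hF' : hf.IsLift p F') {a b : tubeCover R}
    (h : F' a = F b) : range F' = range F := by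
  obtain ⟨n, m, rfl⟩ := hF.exists_eq_comp_tubeShift hp hF' h
  exact (surjective_tubeShift R θ ℓ τ n m).range_comp F

theorem IsLift.isOpen_range {hf : IsTubeChart θ R ℓ τ f U} (hp : IsCoveringMap p)
    {F : tubeCover R → X} (hF : hf.IsLift p F) : IsOpen (range F) := by
  rw [isOpen_iff_mem_nhds]
  rintro _ ⟨a, rfl⟩
  obtain ⟨e, hae, he⟩ := hp.isLocalHomeomorph (F a)
  have h1 : F ⁻¹' e.source ∈ 𝓝 a :=
    hF.continuous.continuousAt.preimage_mem_nhds (e.open_source.mem_nhds hae)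
  have h2 := hf.isOpenMap_coverMap.image_mem_nhds h1
  rw [← hF.comp] at h2
  have h3 := hp.continuous.continuousAt.preimage_mem_nhds h2
  refine mem_of_superset (inter_mem h3 (e.open_source.mem_nhds hae)) ?_
  rintro x ⟨⟨b, hb, hbx⟩, hx⟩
  refine ⟨b, e.injOn hb hx ?_⟩
  rw [← he, hF.comp, hbx]

/-- Ranges of lifts are open, connected, pairwise equal or disjoint, and cover the preimage of the
tube; hence they are its components. -/
theorem IsLift.range_eq_connectedComponentIn {hf : IsTubeChart θ R ℓ τ f U} (hp : IsCoveringMap p)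
    {F : tubeCover R → X} (hF : hf.IsLift p F) (a : tubeCover R) :
    range F = connectedComponentIn {y | (p y : N) ∈ U} (F a) := by
  have := hf.simplyConnectedSpace
  have hmem : ∀ b, (p (F b) : N) ∈ U := fun b => by rw [hF.comp]; exact hf.coverMap_mem b
  apply Subset.antisymm
  · refine (isPreconnected_range hF.continuous).subset_connectedComponentIn (mem_range_self a) ?_
    rintro _ ⟨b, rfl⟩
    exact hmem b
  · let S : Set X := ⋃ F' : {F' : tubeCover R → X // hf.IsLift p F' ∧ Disjoint (range F) (range F')},
      range F'.1
    have hS : IsOpen S := isOpen_iUnion fun F' => F'.2.1.isOpen_range hp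
    have hdisj : Disjoint (range F) S := disjoint_iUnion_right.2 fun F' => F'.2.2
    refine isPreconnected_connectedComponentIn.subset_left_of_subset_union (hF.isOpen_range hp) hS
      hdisj ?_ ⟨F a, mem_connectedComponentIn (hmem a), mem_range_self a⟩
    intro x hx
    have hxU := connectedComponentIn_subset _ _ hx
    obtain ⟨F', hF', b, rfl⟩ := hf.exists_isLift hp hxU
    by_cases h : Disjoint (range F) (range F')
    · exact Or.inr (mem_iUnion.2 ⟨⟨F', hF', h⟩, mem_range_self b⟩)
    · obtain ⟨y, ⟨c, hc⟩, ⟨d, hd⟩⟩ := not_disjoint_iff.1 h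
      left
      rw [← hF.range_eq_of_eq hp hF' (hd.trans hc.symm)]
      exact mem_range_self b

theorem exists_isLift_range_eq (hf : IsTubeChart θ R ℓ τ f U) (hp : IsCoveringMap p) {U₀ : Set X}
    (hU₀ : IsLiftComponent p U U₀) : ∃ F, hf.IsLift p F ∧ range F = U₀ := by
  obtain ⟨x, hx, rfl⟩ := hU₀
  obtain ⟨F, hF, a, rfl⟩ := hf.exists_isLift hp hx
  exact ⟨F, hF, hF.range_eq_connectedComponentIn hp a⟩

/-- A peripheral element acts on a lift of the tube as a shift. -/
theorem IsLift.exists_deck_eq {hf : IsTubeChart θ R ℓ τ f U} (hp : IsCoveringMap p)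
    {F : tubeCover R → X} (hF : hf.IsLift p F) {γ : deckGroup p}
    (hγ : γ ∈ peripheralSubgroup p (range F)) :
    ∃ n m : ℤ, ∀ a, γ.1 (F a) = F (HypCone.tubeShift R θ ℓ τ n m a) := by
  have hγ' : γ.1 '' range F = range F := hγ
  have : Nonempty (tubeCover R) := ⟨⟨(R / 2, 0, 0), by simp [tubeCover, hf.radius_pos]⟩⟩
  obtain ⟨a⟩ := this
  obtain ⟨b, hb⟩ : γ.1 (F a) ∈ range F := by
    rw [← hγ']; exact mem_image_of_mem _ (mem_range_self a)
  obtain ⟨n, m, h⟩ := hF.exists_eq_comp_tubeShift hp (hF.deck γ) hb.symm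
  exact ⟨n, m, fun a => congrFun h a⟩

/-! ### The developing map on a lift of the tube -/

/-- After applying `h⁻¹`, the developing map on the lift `F` of the tube is given by cylindrical
coordinates around the geodesic from `0` to `∞`. -/
def IsFrame (dev : X → H3) (F : tubeCover R → X) (h : SL(2, ℂ)) (χ : ℝ → ℂ) : Prop :=
  (∀ φ, ‖χ φ‖ = 1) ∧ ∀ a : tubeCover R,
    (h⁻¹ • dev (F a)).1 = hermMatrix (Real.exp a.1.2.2 * Real.cosh a.1.1)
      (Real.exp (-a.1.2.2) * Real.cosh a.1.1) (Real.sinh a.1.1 * χ a.1.2.1)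

theorem IsLift.exists_isFrame {hf : IsTubeChart θ R ℓ τ f U} {F : tubeCover R → X}
    (hF : hf.IsLift p F) {dev : X → H3}
    (hdev : ∀ x, ∃ V ∈ 𝓝 x, ∀ y ∈ V, ∀ y' ∈ V, (dev y).dist (dev y') = dist (p y) (p y')) :
    ∃ h χ, IsFrame dev F h χ := by
  refine exists_cylindrical_frame hf.radius_pos (E := fun a => dev (F a)) fun y => ?_
  obtain ⟨V, hV, H⟩ := hdev (F y)
  obtain ⟨W, hW, H'⟩ := hf.exists_isometric_nhds y
  refine ⟨W ∩ F ⁻¹' V, inter_mem hW (hF.continuous.continuousAt.preimage_mem_nhds hV), ?_⟩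
  rintro b ⟨hb, hb'⟩ c ⟨hc, hc'⟩
  have h1 : 1 ≤ (detPolar (cylMatrix b) (cylMatrix c)).re / 2 := by
    rw [detPolar_cylMatrix, Complex.ofReal_re, mul_div_cancel_left₀ _ two_ne_zero]
    have e1 := Real.one_le_cosh (b.1.1 - c.1.1)
    have e2 := Real.one_le_cosh (b.1.2.2 - c.1.2.2)
    have e3 := Real.cos_le_one (b.1.2.1 - c.1.2.1)
    have e4 := mul_pos (Real.sinh_pos_iff.2 b.2.1) (Real.sinh_pos_iff.2 c.2.1)
    have e5 := mul_pos (Real.cosh_pos b.1.1) (Real.cosh_pos c.1.1)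
    rw [Real.cosh_sub] at e1
    nlinarith
  rw [H3.detPolar_eq_of_dist h1 (by rw [H _ hb' _ hc', hF.comp, hF.comp, H' b hb c hc]),
    detPolar_cylMatrix, Complex.ofReal_re, mul_div_cancel_left₀ _ two_ne_zero]

/-- A peripheral element shifts the angle and the height and keeps the radius, so in the frame it
translates the diagonal entries. The angle enters only off the diagonal, so `χ` plays no role. -/
theorem IsLift.fixesAxis {hf : IsTubeChart θ R ℓ τ f U} (hp : IsCoveringMap p)
    {F : tubeCover R → X} (hF : hf.IsLift p F) {dev : X → H3} {h : SL(2, ℂ)} {χ : ℝ → ℂ}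
    (hframe : IsFrame dev F h χ) {γ : deckGroup p} (hγ : γ ∈ peripheralSubgroup p (range F))
    {G : SL(2, ℂ)} (hG : ∀ x, dev (γ.1 x) = G • dev x) : FixesAxis (h⁻¹ * G * h) := by
  obtain ⟨n, m, hnm⟩ := hF.exists_deck_eq hp hγ
  have hmem : ∀ z : ℝ, (R / 2, (0 : ℝ), z) ∈ tubeCover R := fun z => by
    simp [tubeCover, hf.radius_pos]
  have key : ∀ z : ℝ, (h⁻¹ * G * h).1 * hermMatrix (Real.exp z * Real.cosh (R / 2))
      (Real.exp (-z) * Real.cosh (R / 2)) (Real.sinh (R / 2) * χ 0) *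
      (h⁻¹ * G * h).1.conjTranspose = hermMatrix (Real.exp (z + n * ℓ) * Real.cosh (R / 2))
      (Real.exp (-(z + n * ℓ)) * Real.cosh (R / 2))
      (Real.sinh (R / 2) * χ (0 + (n * τ + m * θ))) := by
    intro z
    have h1 := hframe.2 ⟨_, hmem z⟩
    have h2 := hframe.2 (HypCone.tubeShift R θ ℓ τ n m ⟨_, hmem z⟩)
    rw [← hnm, hG] at h2
    have h3 : h⁻¹ • G • dev (F ⟨_, hmem z⟩) = (h⁻¹ * G * h) • h⁻¹ • dev (F ⟨_, hmem z⟩) := by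
      simp only [smul_smul]
      congr 1
      group
    rw [h3, H3.coe_smul, h1] at h2
    exact h2
  refine fixesAxis_of_translation (k := Real.cosh (R / 2)) (e := n * ℓ)
    (b := Real.sinh (R / 2) * χ 0) (Real.cosh_pos _)
    (fun z => ?_) (fun z => ?_)
  · rw [key]; rfl
  · rw [key]; rfl

/-! ### Geodesics which end on the axis -/

/-- A geodesic which leaves the core of the tube and stays in the tube for time `R`, but no longer,
is perpendicular to the core. -/
theorem IsLift.perpendicular {hf : IsTubeChart θ R ℓ τ f U} (hp : IsCoveringMap p)
    (hknot : Nonempty (singularLocus N ≃ₜ Circle)) {F : tubeCover R → X} (hF : hf.IsLift p F)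
    {dev : X → H3}
    (hdev : ∀ x, ∃ V ∈ 𝓝 x, ∀ y ∈ V, ∀ y' ∈ V, (dev y).dist (dev y') = dist (p y) (p y'))
    {h : SL(2, ℂ)} {χ : ℝ → ℂ} (hframe : IsFrame dev F h χ)
    {K : Matrix (Fin 2) (Fin 2) ℂ × Matrix (Fin 2) (Fin 2) ℂ} (hK : IsNullPair K) {σ : ℝ → X}
    (hσK : ∀ s ∈ Ioo (-R) R, (h⁻¹ • dev (σ s)).1 = geodesicLine K s)
    (hσc : ContinuousOn σ (Ioo (-R) R))
    (hσ0 : Tendsto (fun s => Metric.infDist (p (σ s) : N) (singularLocus N)) (𝓝[>] (-R)) (𝓝 0))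
    (hσF : ∀ s ∈ Ioo (-R) 0, σ s ∈ range F) (hσ : σ 0 ∉ range F) :
    geodesicLine K (-R) 0 1 = 0 ∧ ‖geodesicLine K R 0 1‖ = Real.sinh (2 * R) := by
  have hR := hf.radius_pos
  have hFσ : ∀ s ∈ Ioo (-R) 0, ∃ a, F a = σ s ∧ geodesicLine K s =
      hermMatrix (Real.exp a.1.2.2 * Real.cosh a.1.1) (Real.exp (-a.1.2.2) * Real.cosh a.1.1)
        (Real.sinh a.1.1 * χ a.1.2.1) := by
    intro s hs
    obtain ⟨a, ha⟩ := hσF s hs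
    refine ⟨a, ha, ?_⟩
    rw [← hframe.2 a, ha, hσK s ⟨hs.1, hs.2.trans hR⟩]
  have hnorm : ∀ r φ : ℝ, 0 < r → ‖(Real.sinh r : ℂ) * χ φ‖ = Real.sinh r := by
    intro r φ hr
    rw [norm_mul, hframe.1, mul_one, Complex.norm_real, Real.norm_eq_abs,
      abs_of_pos (Real.sinh_pos_iff.2 hr)]
  have hcont : Continuous fun s => geodesicLine K s 0 1 :=
    (continuous_geodesicLine K).matrix_elem 0 1
  -- The modulus of the off-diagonal entry is the hyperbolic sine of the distance from the axis,
  -- which tends to 0 at the start of the arc.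
  have h0 : geodesicLine K (-R) 0 1 = 0 := by
    have h1 : Tendsto (fun s => geodesicLine K s 0 1) (𝓝[>] (-R)) (𝓝 (geodesicLine K (-R) 0 1)) :=
      (hcont.tendsto _).mono_left nhdsWithin_le_nhds
    refine tendsto_nhds_unique h1 ?_
    rw [Metric.tendsto_nhds]
    intro e he
    obtain ⟨δ, hδ, H⟩ := hf.radius_lt_of_infDist_lt hknot (Real.arsinh_pos_iff.2 he)
    have h3 : Ioo (-R) 0 ∈ 𝓝[>] (-R) := Ioo_mem_nhdsGT (by linarith)
    filter_upwards [hσ0.eventually (gt_mem_nhds hδ), h3] with s hs hs'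
    obtain ⟨a, ha, ha'⟩ := hFσ s hs'
    rw [← ha, hF.comp] at hs
    have h4 := Real.sinh_lt_sinh.2 (H a hs)
    rw [Real.sinh_arsinh] at h4
    rw [dist_zero_right, ha']
    change ‖(Real.sinh a.1.1 : ℂ) * χ a.1.2.1‖ < e
    rwa [hnorm _ _ a.2.1]
  refine ⟨h0, ?_⟩
  obtain ⟨w, hw, hKw⟩ := hK.exists_slope h0
  suffices hw1 : ‖w‖ = 1 by
    rw [hKw, norm_mul, hw1, one_mul, Complex.norm_real, Real.norm_eq_abs, ← two_mul,
      abs_of_pos (Real.sinh_pos_iff.2 (by linarith))]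
  -- With slope less than 1 the radius stays below `R` up to and including time 0. The geodesic,
  -- written in cylindrical coordinates, then lifts through `F` to a curve that agrees with `σ`,
  -- which puts `σ 0` in the range of `F`.
  by_contra hne
  have hlt : ‖w‖ < 1 := lt_of_le_of_ne hw hne
  have hs₁ : -(R / 2) ∈ Ioo (-R) 0 := ⟨by linarith, by linarith⟩
  obtain ⟨a₁, ha₁, hKa₁⟩ := hFσ _ hs₁
  have hχ : (Real.sinh a₁.1.1 : ℂ) * χ a₁.1.2.1 = w * Real.sinh (R / 2) := by
    rw [show R / 2 = -(R / 2) + R by ring, ← hKw, hKa₁]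
    rfl
  have hsR : 0 < Real.sinh (R / 2) := Real.sinh_pos_iff.2 (by linarith)
  have hs₁' : Real.sinh a₁.1.1 = ‖w‖ * Real.sinh (R / 2) := by
    rw [← hnorm _ a₁.1.2.1 a₁.2.1, hχ, norm_mul, Complex.norm_real, Real.norm_eq_abs, abs_of_pos hsR]
  have hw0 : 0 < ‖w‖ := by
    have := Real.sinh_pos_iff.2 a₁.2.1
    rw [hs₁'] at this
    exact pos_of_mul_pos_left this hsR.le
  have hwχ : (‖w‖ : ℂ) * χ a₁.1.2.1 = w := by
    have h1 : (Real.sinh (R / 2) : ℂ) ≠ 0 := by exact_mod_cast hsR.ne'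
    apply mul_right_cancel₀ h1
    rw [← hχ, hs₁', Complex.ofReal_mul]
    ring
  -- The geodesic in cylindrical coordinates.
  let r : ℝ → ℝ := fun s => Real.arsinh (‖w‖ * Real.sinh (s + R))
  let k : ℝ → ℝ := fun s => (geodesicLine K s 0 0).re
  let z : ℝ → ℝ := fun s => Real.log (k s / Real.cosh (r s))
  have hIoc : ∀ s ∈ Ioc (-R) 0, s ∈ Ioo (-R) R := fun s hs => ⟨hs.1, hs.2.trans_lt hR⟩
  have hk : ∀ s ∈ Ioc (-R) 0, 0 < k s := by
    intro s hs
    change 0 < (geodesicLine K s 0 0).re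
    rw [← hσK s (hIoc s hs)]
    exact H3.diag_pos _ 0
  have hkc : ∀ s ∈ Ioc (-R) 0, 0 < k s / Real.cosh (r s) := fun s hs =>
    div_pos (hk s hs) (Real.cosh_pos _)
  have hr0 : ∀ s ∈ Ioc (-R) 0, 0 < r s := fun s hs =>
    Real.arsinh_pos_iff.2 (mul_pos hw0 (Real.sinh_pos_iff.2 (by linarith [hs.1])))
  have hrR : ∀ s ∈ Ioc (-R) 0, r s < R := by
    intro s hs
    have h1 : 0 < Real.sinh (s + R) := Real.sinh_pos_iff.2 (by linarith [hs.1])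
    rw [← Real.sinh_lt_sinh, Real.sinh_arsinh]
    have h2 : Real.sinh (s + R) ≤ Real.sinh R := Real.sinh_le_sinh.2 (by linarith [hs.2])
    nlinarith
  -- The angle is constant because a geodesic meeting the axis stays in a half-plane. The interval
  -- includes 0, where the contradiction occurs.
  let y : Ioc (-R) 0 → tubeCover R := fun s =>
    ⟨(r s, a₁.1.2.1, z s), hr0 s s.2, hrR s s.2⟩
  have hkcont : Continuous k := Complex.continuous_re.comp
    ((continuous_geodesicLine K).matrix_elem 0 0)
  have hrcont : Continuous r := Real.continuous_arsinh.comp (by fun_prop)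
  have hycont : Continuous y := by
    refine Continuous.subtype_mk ?_ _
    refine (hrcont.comp continuous_subtype_val).prodMk (continuous_const.prodMk ?_)
    refine Continuous.log ?_ fun s => (hkc s s.2).ne'
    exact (hkcont.comp continuous_subtype_val).div
      (Real.continuous_cosh.comp (hrcont.comp continuous_subtype_val)) fun s =>
        (Real.cosh_pos _).ne'
  have hyσ : ∀ s : Ioc (-R) 0, h⁻¹ • dev (F (y s)) = h⁻¹ • dev (σ s) := by
    rintro ⟨s, hs⟩
    apply Subtype.ext
    have hdet := (h⁻¹ • dev (σ s)).det_entries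
    rw [hσK s (hIoc s hs), hKw, Complex.normSq_eq_norm_sq, norm_mul, Complex.norm_real,
      mul_pow, Real.norm_eq_abs, sq_abs] at hdet
    have hsr : Real.sinh (r s) = ‖w‖ * Real.sinh (s + R) := Real.sinh_arsinh _
    have hcr := Real.cosh_sq (r s)
    rw [hsr] at hcr
    have hez : Real.exp (z s) = k s / Real.cosh (r s) := Real.exp_log (hkc s hs)
    have hc0 := (Real.cosh_pos (r s)).ne'
    have hk0 := (hk s hs).ne'
    rw [hframe.2, hσK s (hIoc s hs), exists_hermMatrix (hK.isHermitian s), hKw]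
    have e1 : Real.exp (z s) * Real.cosh (r s) = k s := by
      rw [hez, div_mul_cancel₀ _ hc0]
    have e2 : Real.exp (-z s) * Real.cosh (r s) = (geodesicLine K s 1 1).re := by
      rw [Real.exp_neg, hez, inv_div, div_mul_eq_mul_div, div_eq_iff hk0]
      change _ = _ * (geodesicLine K s 0 0).re
      linear_combination hcr - hdet
    have e3 : (Real.sinh (r s) : ℂ) * χ a₁.1.2.1 = w * Real.sinh (s + R) := by
      rw [hsr, Complex.ofReal_mul]
      linear_combination (Real.sinh (s + R) : ℂ) * hwχ
    change hermMatrix (Real.exp (z s) * Real.cosh (r s)) (Real.exp (-z s) * Real.cosh (r s))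
      (Real.sinh (r s) * χ a₁.1.2.1) = _
    rw [e1, e2, e3]
  have hdevσ : dev ∘ (F ∘ y) = dev ∘ fun s : Ioc (-R) 0 => σ s := by
    funext s
    exact smul_left_cancel _ (hyσ s)
  -- Local injectivity of `dev` gives uniqueness of lifts along `dev`: `F ∘ y` and `σ` have the same
  -- development and agree at `-R / 2`.
  have hlin : IsLocallyInjective dev := by
    rw [isLocallyInjective_iff_nhds]
    intro x
    obtain ⟨V, hV, H⟩ := hdev x
    obtain ⟨V', hV', H'⟩ := isLocallyInjective_iff_nhds.1
      hp.isLocalHomeomorph.isLocallyInjective x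
    refine ⟨V ∩ V', inter_mem hV hV', ?_⟩
    rintro u ⟨hu, hu'⟩ v ⟨hv, hv'⟩ huv
    refine H' hu' hv' (dist_eq_zero.1 ?_)
    rw [← H u hu v hv, huv, H3.dist_self]
  have : T2Space X := t2Space_of_isCoveringMap hp
  have : PreconnectedSpace (Ioc (-R) 0) := Subtype.preconnectedSpace isPreconnected_Ioc
  have hya₁ : y ⟨-(R / 2), hs₁.1, hs₁.2.le⟩ = a₁ := by
    have e1 : r (-(R / 2)) = a₁.1.1 := by
      change Real.arsinh (‖w‖ * Real.sinh (-(R / 2) + R)) = _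
      rw [show -(R / 2) + R = R / 2 by ring, ← hs₁', Real.arsinh_sinh]
    refine Subtype.ext (Prod.ext e1 (Prod.ext rfl ?_))
    change Real.log ((geodesicLine K (-(R / 2)) 0 0).re / Real.cosh (r (-(R / 2)))) = _
    rw [e1, hKa₁]
    change Real.log ((((Real.exp a₁.1.2.2 * Real.cosh a₁.1.1 : ℝ) : ℂ)).re / _) = _
    rw [Complex.ofReal_re, mul_div_cancel_right₀ _ (Real.cosh_pos _).ne', Real.log_exp]
  have heq := (T2Space.isSeparatedMap dev).eq_of_comp_eq hlin (hF.continuous.comp hycont)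
    (continuousOn_iff_continuous_domRestrict.1 (hσc.mono hIoc)) hdevσ
    ⟨-(R / 2), hs₁.1, hs₁.2.le⟩ (by
      change F (y _) = σ _
      rw [hya₁, ha₁])
  exact hσ ⟨_, congrFun heq ⟨0, by linarith, le_rfl⟩⟩

end IsTubeChart

/-! ### Tie arcs, double cosets and the distance between axes. -/

theorem mapPair_mapPair (g g' : Matrix (Fin 2) (Fin 2) ℂ)
    (K : Matrix (Fin 2) (Fin 2) ℂ × Matrix (Fin 2) (Fin 2) ℂ) :
    mapPair g (mapPair g' K) = mapPair (g * g') K := by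
  simp only [mapPair, Matrix.conjTranspose_mul, Matrix.mul_assoc]

/-- Representatives of a double coset of the stabilizer of the axis have the same `axisCosh`. -/
theorem axisCosh_conj_eq {h A X G₁ G₂ : SL(2, ℂ)} (h₁ : FixesAxis (h⁻¹ * G₁ * h))
    (h₂ : FixesAxis (h⁻¹ * G₂ * h)) (hA : (A : PSL2C) = (G₁ : PSL2C) * X * G₂) :
    axisCosh (h⁻¹ * A * h) = axisCosh (h⁻¹ * X * h) := by
  have hA' : ((G₁ * X * G₂ : SL(2, ℂ)) : PSL2C) = (A : PSL2C) := hA.symm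
  rw [QuotientGroup.eq] at hA'
  -- Equality in `PSL2C` leaves a central factor, which commutes with `h` and fixes the axis.
  set Z := (G₁ * X * G₂)⁻¹ * A with hZ
  have hconj : h⁻¹ * Z * h = Z := by
    rw [mul_assoc, ← Subgroup.mem_center_iff.1 hA' h]; group
  have : h⁻¹ * A * h = (h⁻¹ * G₁ * h) * (h⁻¹ * X * h) * (h⁻¹ * G₂ * h) * (h⁻¹ * Z * h) := by
    rw [hZ]; group
  rw [this, hconj, axisCosh_mul_right (fixesAxis_of_mem_center hA'), axisCosh_mul_right h₂,
    axisCosh_mul_left h₁]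

variable {N : Type*} [MetricSpace N] {θ R ℓ τ : ℝ} {f : Cyl → N} {U : Set N}
  {X : Type*} [TopologicalSpace X] {p : X → regularPart N}

/-- The development of a tie arc is a geodesic. -/
theorem IsTieArc.exists_eq_geodesicLine (hR : 0 < R) {U₀ U₀' : Set X} {σ : ℝ → X}
    (hσ : IsTieArc p R U₀ U₀' σ) {dev : X → H3}
    (hdev : ∀ x, ∃ V ∈ 𝓝 x, ∀ y ∈ V, ∀ y' ∈ V, (dev y).dist (dev y') = dist (p y) (p y')) :
    ∃ K, IsNullPair K ∧ ∀ s ∈ Ioo (-R) R, (dev (σ s)).1 = geodesicLine K s := by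
  refine HypCone.exists_eq_geodesicLine (c := fun s => dev (σ s)) hR fun s hs => ?_
  obtain ⟨δ, hδ, H⟩ := hσ.geodesic s hs
  obtain ⟨V, hV, H'⟩ := hdev (σ s)
  have h1 := (hσ.continuousOn.continuousAt (isOpen_Ioo.mem_nhds hs)).preimage_mem_nhds hV
  obtain ⟨η, hη, hball⟩ := Metric.mem_nhds_iff.1 h1
  refine ⟨min δ η, lt_min hδ hη, fun s₁ h₁ s₂ h₂ h₁' h₂' => ?_⟩
  rw [H' (σ s₁) (hball (h₁'.trans_le (min_le_right _ _)))
    (σ s₂) (hball (h₂'.trans_le (min_le_right _ _)))]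
  exact H s₁ h₁ s₂ h₂ (h₁'.trans_le (min_le_left _ _)) (h₂'.trans_le (min_le_left _ _))

/-- The axes of the two lifts of the tube which are joined by a tie arc have distance `2R`. -/
theorem IsTubeChart.axisCosh_eq (hf : IsTubeChart θ R ℓ τ f U) (hp : IsCoveringMap p)
    (hknot : Nonempty (singularLocus N ≃ₜ Circle)) {F : tubeCover R → X} (hF : hf.IsLift p F)
    {dev : X → H3}
    (hdev : ∀ x, ∃ V ∈ 𝓝 x, ∀ y ∈ V, ∀ y' ∈ V, (dev y).dist (dev y') = dist (p y) (p y'))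
    {h : SL(2, ℂ)} {χ : ℝ → ℂ} (hframe : IsFrame dev F h χ) {U₀' : Set X} {σ : ℝ → X}
    (hσ : IsTieArc p R (range F) U₀' σ) {β : deckGroup p} (hβ : β.1 '' U₀' = range F)
    {B : SL(2, ℂ)} (hB : ∀ x, dev (β.1 x) = B • dev x) :
    axisCosh (h⁻¹ * B * h) = Real.cosh (2 * R) := by
  have hR := hf.radius_pos
  have hopen : IsOpen (range F) := hF.isOpen_range hp
  have hβmem : ∀ x, β.1 x ∈ range F ↔ x ∈ U₀' := fun x => by
    rw [← hβ, β.1.injective.mem_set_image]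
  have hopen' : IsOpen U₀' := by
    have : U₀' = β.1 ⁻¹' range F := Set.ext fun x => (hβmem x).symm
    rw [this]
    exact hopen.preimage β.1.continuous
  obtain ⟨K, hK, hKσ⟩ := hσ.exists_eq_geodesicLine hR hdev
  have h1 := hF.perpendicular hp hknot hdev hframe (hK.map h⁻¹.2) (σ := σ)
    (fun s hs => by rw [H3.coe_smul, hKσ s hs, geodesicLine_mapPair])
    hσ.continuousOn hσ.start hσ.left
    (disjoint_right.1 (disjoint_frontier_iff_isOpen.2 hopen).symm hσ.mid.1)
  have hneg : ∀ s ∈ Ioo (-R) R, -s ∈ Ioo (-R) R := fun s hs =>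
    ⟨by linarith [hs.2], by linarith [hs.1]⟩
  -- The arc reversed and moved by `β` also starts on the core of the lift `F`, since `β` carries
  -- `U₀'` to `range F`. This gives perpendicularity at the other end.
  have h2 := hF.perpendicular hp hknot hdev hframe (hK.map (h⁻¹ * B).2).swap
    (σ := fun s => β.1 (σ (-s)))
    (fun s hs => by
      rw [hB, smul_smul, H3.coe_smul, hKσ _ (hneg s hs), geodesicLine_swap, geodesicLine_mapPair])
    (β.1.continuous.comp_continuousOn (hσ.continuousOn.comp continuous_neg.continuousOn hneg))
    (by
      have h3 : Tendsto (fun s : ℝ => -s) (𝓝[>] (-R)) (𝓝[<] R) := tendsto_neg_nhdsGT_neg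
      refine (hσ.finish.comp h3).congr fun s => ?_
      simp only [Function.comp]
      rw [show p (β.1 (σ (-s))) = p (σ (-s)) from β.2 _])
    (fun s hs => (hβmem _).2 (hσ.right _ ⟨by linarith [hs.2], by linarith [hs.1]⟩))
    (by
      simp only [neg_zero, hβmem]
      exact disjoint_right.1 (disjoint_frontier_iff_isOpen.2 hopen').symm hσ.mid.2)
  have hBK : ∀ s, (h⁻¹ * B * h).1 * geodesicLine (mapPair h⁻¹.1 K) s *
      (h⁻¹ * B * h).1.conjTranspose = geodesicLine (mapPair (h⁻¹ * B).1 K) s := by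
    intro s
    rw [← geodesicLine_mapPair, mapPair_mapPair, ← Matrix.SpecialLinearGroup.coe_mul,
      mul_inv_cancel_right]
  rw [geodesicLine_swap, geodesicLine_swap, neg_neg, ← hBK, ← hBK] at h2
  have hK' := hK.map (g := h⁻¹.1) h⁻¹.2
  -- The feet of the common perpendicular are the points of the geodesic at the times `-R` and `R`,
  -- which the arc itself omits.
  refine axisCosh_eq_cosh (hK'.isHermitian (-R)) (hK'.isHermitian R) ?_ ?_ ?_ h1.1 h1.2 h2.1 h2.2
  · rw [hK'.detPolar_geodesicLine]; simp
  · rw [hK'.detPolar_geodesicLine]; simp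
  · rw [hK'.detPolar_geodesicLine, ← Real.cosh_neg, show -(-R - R) = 2 * R by ring]

end HypCone

end

/-- The radius of the maximal tube around the singular knot of a hyperbolic cone-manifold, in terms
of traces. The traces are those of arbitrary representatives `A`, `G` in `SL(2, ℂ)` of `ρ α` and
`ρ γ`. -/
theorem mainTheorem3 {N : Type*} [MetricSpace N] (θ : ℝ)
    (hN : HypCone.IsConeManifoldAlongKnot N θ)
    (R : ℝ) (U : Set N) (hU : HypCone.IsMaximalTube θ R U)
    {X : Type*} [TopologicalSpace X] [SimplyConnectedSpace X]
    (p : X → HypCone.regularPart N) (hp : IsCoveringMap p) (hps : Function.Surjective p)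
    (ρ : HypCone.deckGroup p →* HypCone.PSL2C) (hρ : HypCone.IsHolonomy p ρ)
    (U₀ : Set X) (hU₀ : HypCone.IsLiftComponent p U U₀)
    (α : HypCone.deckGroup p) (hα : HypCone.RepresentsTieClass p R U₀ α)
    (γ : HypCone.deckGroup p) (hγ : γ ∈ HypCone.peripheralSubgroup p U₀) (hγ1 : ρ γ ≠ 1)
    (A G : SL(2, ℂ)) (hA : (A : HypCone.PSL2C) = ρ α) (hG : (G : HypCone.PSL2C) = ρ γ) :
    Real.cosh (2 * R) =
      (‖(A * G * A⁻¹ * G⁻¹).1.trace - 2‖ +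
        ‖G.1.trace ^ 2 - (A * G * A⁻¹ * G⁻¹).1.trace - 2‖) / ‖G.1.trace ^ 2 - 4‖ := by
  obtain ⟨⟨hR, ℓ, τ, f, hℓ, hiso, heq, hcore, himage⟩, -⟩ := hU
  have hf : HypCone.IsTubeChart θ R ℓ τ f U :=
    ⟨hN.angle_pos, hN.angle_lt, hR, hiso, heq, hcore, himage⟩
  obtain ⟨dev, hdev, hequiv⟩ := hρ
  obtain ⟨F, hF, rfl⟩ := hf.exists_isLift_range_eq hp hU₀
  obtain ⟨h, χ, hframe⟩ := hF.exists_isFrame hdev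
  obtain ⟨β, U₀', σ, hσ, hβ, γ₁, hγ₁, γ₂, hγ₂, hαβ⟩ := hα
  obtain ⟨B, hB⟩ := QuotientGroup.mk_surjective (ρ β)
  obtain ⟨G₁, hG₁⟩ := QuotientGroup.mk_surjective (ρ γ₁)
  obtain ⟨G₂, hG₂⟩ := QuotientGroup.mk_surjective (ρ γ₂)
  have h₁ := hF.fixesAxis hp hframe hγ₁ (hequiv γ₁ G₁ hG₁)
  have h₂ := hF.fixesAxis hp hframe hγ₂ (hequiv γ₂ G₂ hG₂)
  have hGaxis := hF.fixesAxis hp hframe hγ (hequiv γ G hG)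
  have hBR := hf.axisCosh_eq hp hN.knot hF hdev hframe hσ hβ (hequiv β B hB)
  rw [← HypCone.axisCosh_eq_trace (h := h) hGaxis (by rwa [hG]), ← hBR]
  -- Both forms of the tie relation reduce to `β`: the peripheral factors are diagonal in the frame,
  -- and inversion preserves `axisCosh`.
  rcases hαβ with rfl | rfl
  · exact (HypCone.axisCosh_conj_eq (A := A) h₁ h₂ (by
      rw [hA, map_mul, map_mul, ← hB, ← hG₁, ← hG₂])).symm
  · rw [HypCone.axisCosh_conj_eq (A := A) (X := B⁻¹) h₁ h₂ (by
      rw [hA, map_mul, map_mul, map_inv, ← hB, ← hG₁, ← hG₂]; rfl),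
      ← HypCone.axisCosh_inv]
    congr 1
    group
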